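/- Let $K$ be a field and let $\Gamma$ be a pointed affine semigroup, i.e. a finitely generated, cancellative, torsion-free commutative monoid whose only invertible element is $0$. Let $M$ be the group generated by $\Gamma$, $N=\mathrm{Hom}(M,\mathbb Z)$, $N_{\mathbb R}=\mathrm{Hom}(M,\mathbb R)$, let $\sigma\subset N_{\mathbb R}$ be the cone of all $w$ that are nonnegative on $\Gamma$, and let $\check\sigma\cap M=\{v\in M : nv\in\Gamma \text{ for some } n\ge 1\}$ be the saturation of $\Gamma$. Let $L(\sigma,N)$ be the set of monoid morphisms $\check\sigma\cap M\to\mathbb R\cup\{\infty\}$, with the topology of pointwise convergence. Let $\overline\sigma\subset L(\sigma,N)$ be the subset of morphisms with values in $[0,\infty]$, and let $\overline\sigma^\circ\subset\overline\sigma$ be the subset of those which are positive (possibly $\infty$) on all non-invertible elements of $\check\sigma\cap M$. For every face $\tau$ of $\sigma$, let $N_\tau=N\cap\mathrm{span}(\tau)$; the stratum $(N/N_\tau)_{\mathbb R}=N_{\mathbb R}/\mathrm{span}(\tau)$ is embedded in $L(\sigma,N)$ by sending the class of $w$ to the morphism equal to $w$ on $\check\sigma\cap M\cap\tau^\perp$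 and to $\infty$ on the rest of $\check\sigma\cap M$. A subset of $L(\sigma,N)$ is a rational PL conical subspace if its intersection with each stratum $(N/N_\tau)_{\mathbb R}$ is empty or a finite union of convex polyhedral cones that are rational with respect to the lattice $N/N_\tau$. A rational PL conical subspace in $\overline\sigma$ is one that is contained in $\overline\sigma$; a rational PL conical subspace in $\overline\sigma^\circ$ is the intersection with $\overline\sigma^\circ$ of a rational PL conical subspace of $L(\sigma,N)$. Let $I$ be an arbitrary ideal of the ring $K[[\Gamma]]$ of formal power series $\sum_{m\in\Gamma}a_m\chi^m$, let $R=K[[\Gamma]]/I$, and let $\gamma\colon\Gamma\to(R,\cdot)$, $m\mapsto\chi^m \bmod I$. A real valuation of $R$ is a map $v\colon R\to\mathbb R\cup\{\infty\}$ with $v(0)=\infty$, $v(1)=0$, $v(fg)=v(f)+v(g)$ and $v(f+g)\ge\min\{v(f),v(g)\}$; the morphism $v\circ\gamma$ on $\Gamma$ extends uniquely to a point $\Phi_\gamma(v)$ of $L(\sigma,N)$. Let $\mathrm{trop}_{\ge 0}(I)$ (the local nonnegative tropicalization) be the set of all $\Phi_\gamma(v)$ with $v\ge 0$ on $R$, and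 let $\mathrm{trop}_{>0}(I)$ (the local positive tropicalization) be the closure in $\overline\sigma^\circ$ of the set of all $\Phi_\gamma(v)$ with $v\ge 0$ on $R$ and $v>0$ on the non-units of $R$. Then $\mathrm{trop}_{\ge 0}(I)$ is a rational PL conical subspace in $\overline\sigma$, and $\mathrm{trop}_{>0}(I)$ is a rational PL conical subspace in $\overline\sigma^\circ$. -/

import Mathlib

open Algebra

set_option linter.unusedSectionVars false

noncomputable section

/-! ### The formal power series ring `K[[Γ]]` of a pointed affine semigroup `Γ`

Throughout, an affine semigroup is a commutative monoid which is cancellative, finitely generated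
and torsion-free; it is pointed when `0` is its only invertible element
(`Subsingleton (AddUnits Γ)`). -/

/-- Formal series `∑ a_m χ^m` with `m ∈ Γ` and `a_m ∈ K`, encoded by the coefficients `m ↦ a_m`. -/
def FormalToricRing (K Γ : Type*) : Type _ := Γ → K

/-- In a finitely generated cancellative pointed monoid, every element is in only finitely many
ways a sum of two elements. -/
theorem finite_decompositions {Γ : Type*} [AddCancelCommMonoid Γ] [AddMonoid.FG Γ]
    [Subsingleton (AddUnits Γ)] (m : Γ) : {p : Γ × Γ | p.1 + p.2 = m}.Finite := by
  have hfin : Module.Finite ℕ Γ := Module.Finite.iff_addMonoid_fg.2 inferInstance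
  obtain ⟨n, φ, hφ⟩ := Module.Finite.exists_fin' ℕ Γ
  by_contra hinf
  let e := Set.Infinite.natEmbedding _ hinf
  choose g hg using hφ
  let q : ℕ → (Fin n → ℕ) × (Fin n → ℕ) := fun i => (g (e i).1.1, g (e i).1.2)
  obtain ⟨i, j, hij, hle⟩ := wellQuasiOrdered_le q
  obtain ⟨c, hc⟩ := exists_add_of_le hle.1
  obtain ⟨d, hd⟩ := exists_add_of_le hle.2
  have h1 : (e j).1.1 = (e i).1.1 + φ c := by
    rw [← hg (e j).1.1, ← hg (e i).1.1, ← map_add]; exact congrArg φ hc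
  have h2 : (e j).1.2 = (e i).1.2 + φ d := by
    rw [← hg (e j).1.2, ← hg (e i).1.2, ← map_add]; exact congrArg φ hd
  have hi : (e i).1.1 + (e i).1.2 = m := (e i).2
  have hj : (e j).1.1 + (e j).1.2 = m := (e j).2
  have h0 : φ c + φ d = 0 := by
    rw [h1, h2, add_add_add_comm, hi] at hj
    simpa using hj
  have hc0 : φ c = 0 := by
    have := Subsingleton.elim (⟨φ c, φ d, h0, by rw [add_comm]; exact h0⟩ : AddUnits Γ) 0
    exact congrArg AddUnits.val this
  have hd0 : φ d = 0 := by simpa [hc0] using h0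
  have : e i = e j := by
    apply Subtype.ext
    apply Prod.ext
    · rw [h1, hc0, add_zero]
    · rw [h2, hd0, add_zero]
  exact hij.ne (e.injective this)

namespace FormalToricRing

variable {K Γ : Type*} [Field K] [AddCancelCommMonoid Γ] [AddMonoid.FG Γ]
  [Subsingleton (AddUnits Γ)]

/-- The finitely many pairs `(a, b)` with `a + b = m`. -/
def pairs (m : Γ) : Finset (Γ × Γ) := (finite_decompositions m).toFinset

theorem mem_pairs {m : Γ} {p : Γ × Γ} : p ∈ pairs m ↔ p.1 + p.2 = m := by simp [pairs]

instance : AddCommGroup (FormalToricRing K Γ) := inferInstanceAs (AddCommGroup (Γ → K))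

/-- The monomial `χ^m`. -/
def monomial (m : Γ) : FormalToricRing K Γ := fun a => by classical exact if a = m then 1 else 0

instance : One (FormalToricRing K Γ) := ⟨monomial 0⟩

/-- `(∑ a_m χ^m) (∑ b_m χ^m) = ∑ c_m χ^m` with `c_m = ∑_{m₁ + m₂ = m} a_{m₁} b_{m₂}`. -/
instance : Mul (FormalToricRing K Γ) := ⟨fun f g m => ∑ p ∈ pairs m, f p.1 * g p.2⟩

theorem mul_apply (f g : FormalToricRing K Γ) (m : Γ) :
    (f * g) m = ∑ p ∈ pairs m, f p.1 * g p.2 := rfl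

theorem add_apply (f g : FormalToricRing K Γ) (m : Γ) : (f + g) m = f m + g m := rfl

theorem zero_apply (m : Γ) : (0 : FormalToricRing K Γ) m = 0 := rfl

theorem one_eq : (1 : FormalToricRing K Γ) = monomial 0 := rfl

theorem monomial_apply (m a : Γ) [Decidable (a = m)] :
    (monomial m : FormalToricRing K Γ) a = if a = m then 1 else 0 := by
  unfold monomial; split_ifs <;> rfl

protected theorem mul_comm (f g : FormalToricRing K Γ) : f * g = g * f := by
  funext m
  rw [mul_apply, mul_apply]
  refine Finset.sum_nbij' Prod.swap Prod.swap ?_ ?_ ?_ ?_ ?_ <;>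
    simp +contextual [mem_pairs, add_comm, mul_comm]

protected theorem mul_assoc (f g h : FormalToricRing K Γ) : f * g * h = f * (g * h) := by
  funext m
  simp only [mul_apply, Finset.sum_mul, Finset.mul_sum, Finset.sum_sigma']
  apply Finset.sum_nbij' (fun ⟨⟨_i, j⟩, ⟨k, l⟩⟩ ↦ ⟨(k, l + j), (l, j)⟩)
    (fun ⟨⟨i, _j⟩, ⟨k, l⟩⟩ ↦ ⟨(i + k, l), (i, k)⟩) <;>
    simp +contextual [mem_pairs, add_assoc, mul_assoc]
  · rintro ⟨⟨a, b⟩, ⟨c, d⟩⟩ rfl h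
    dsimp only at h ⊢
    rw [← h]
    abel

protected theorem one_mul (f : FormalToricRing K Γ) : 1 * f = f := by
  classical
  funext m
  rw [mul_apply, Finset.sum_eq_single (0, m)]
  · simp [one_eq, monomial_apply]
  · rintro ⟨a, b⟩ hab hne
    have : a ≠ 0 := by
      rintro rfl
      apply hne
      simpa [mem_pairs] using hab
    simp [one_eq, monomial_apply, this]
  · simp [mem_pairs]

protected theorem mul_add (f g h : FormalToricRing K Γ) : f * (g + h) = f * g + f * h := by
  funext m
  simp [mul_apply, add_apply, mul_add, Finset.sum_add_distrib]

protected theorem mul_zero (f : FormalToricRing K Γ) : f * 0 = 0 := by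
  funext m
  simp [mul_apply, zero_apply]

instance : CommRing (FormalToricRing K Γ) where
  __ := (inferInstance : AddCommGroup (FormalToricRing K Γ))
  mul_comm := FormalToricRing.mul_comm
  mul_assoc := FormalToricRing.mul_assoc
  one_mul := FormalToricRing.one_mul
  mul_one f := by rw [FormalToricRing.mul_comm, FormalToricRing.one_mul]
  left_distrib := FormalToricRing.mul_add
  right_distrib f g h := by
    rw [FormalToricRing.mul_comm, FormalToricRing.mul_add, FormalToricRing.mul_comm h f,
      FormalToricRing.mul_comm h g]
  mul_zero := FormalToricRing.mul_zero
  zero_mul f := by rw [FormalToricRing.mul_comm, FormalToricRing.mul_zero]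

theorem monomial_add (a b : Γ) :
    (monomial (a + b) : FormalToricRing K Γ) = monomial a * monomial b := by
  classical
  funext m
  rw [mul_apply]
  by_cases h : m = a + b
  · subst h
    rw [Finset.sum_eq_single (a, b)]
    · simp [monomial_apply]
    · rintro ⟨c, d⟩ _ hne
      by_cases hc : c = a
      · have hd : d ≠ b := by rintro rfl; exact hne (by rw [hc])
        simp [monomial_apply, hd]
      · simp [monomial_apply, hc]
    · simp [mem_pairs]
  · rw [monomial_apply, if_neg h, Finset.sum_eq_zero]
    rintro ⟨c, d⟩ hp
    by_cases hc : c = a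
    · have hd : d ≠ b := by
        rintro rfl
        subst hc
        exact h (mem_pairs.1 hp).symm
      simp [monomial_apply, hd]
    · simp [monomial_apply, hc]

/-- The natural semigroup morphism `Γ → (K[[Γ]]/I, ·)`, `m ↦ χ^m mod I`. -/
def toQuotient (I : Ideal (FormalToricRing K Γ)) :
    Multiplicative Γ →* FormalToricRing K Γ ⧸ I where
  toFun m := Ideal.Quotient.mk I (monomial m.toAdd)
  map_one' := by rw [toAdd_one, ← one_eq, map_one]
  map_mul' a b := by rw [toAdd_mul, monomial_add, map_mul]

end FormalToricRing

/-! ### The linear variety `L(σ, N)` and the extended cone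

For an affine semigroup `Γ`, the lattice `M` is `GrothendieckAddGroup Γ`, the dual lattice is
`N = Hom(M, ℤ)`, and `N_ℝ` is identified with `Hom(M, ℝ) = (M →+ ℝ)`.
The extended real line `ℝ ∪ {∞}` is `WithTop ℝ` with its order topology. -/

section LinearVariety

variable (Γ : Type*) [AddCancelCommMonoid Γ]

/-- The saturation `{v ∈ M | n v ∈ Γ for some n ≥ 1}` of `Γ`; it equals `σ̌ ∩ M`. -/
def saturation : AddSubmonoid (GrothendieckAddGroup Γ) where
  carrier := {v | ∃ n : ℕ, n ≠ 0 ∧ ∃ a : Γ, n • v = GrothendieckAddGroup.of a}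
  zero_mem' := ⟨1, one_ne_zero, 0, by simp⟩
  add_mem' := by
    rintro v w ⟨n, hn, a, ha⟩ ⟨k, hk, b, hb⟩
    refine ⟨k * n, mul_ne_zero hk hn, k • a + n • b, ?_⟩
    rw [smul_add, mul_smul, ha, mul_comm, mul_smul, hb, map_add, map_nsmul, map_nsmul]

/-- The inclusion `Γ → sat(Γ)`. -/
def toSaturation : Γ →+ saturation Γ :=
  AddMonoidHom.codRestrict GrothendieckAddGroup.of (saturation Γ)
    fun a => ⟨1, one_ne_zero, a, one_smul _ _⟩

/-- The affine linear variety `L(σ, N)`: semigroup morphisms `σ̌ ∩ M → ℝ ∪ {∞}`. -/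
abbrev LinearVariety : Type _ := saturation Γ →+ WithTop ℝ

/-- The topology of pointwise convergence. -/
instance : TopologicalSpace (LinearVariety Γ) :=
  TopologicalSpace.induced (fun w m => w m) Pi.topologicalSpace

/-- The extended cone `σ̄`. -/
def extendedCone : Set (LinearVariety Γ) := {w | ∀ m, 0 ≤ w m}

/-- The interior `σ̄°`: the points of `σ̄` that are positive (possibly infinite) on all
non-invertible elements of `σ̌ ∩ M`. -/
def extendedConeInterior : Set (LinearVariety Γ) :=
  {w | (∀ m, 0 ≤ w m) ∧ ∀ m, ¬ IsAddUnit m → 0 < w m}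

variable {Γ}

theorem withTop_nsmul_injective {n : ℕ} (hn : n ≠ 0) {x y : WithTop ℝ} (h : n • x = n • y) :
    x = y := by
  have key : ∀ z : ℝ, n • (z : WithTop ℝ) = ((n • z : ℝ) : WithTop ℝ) := fun z => by
    rw [WithTop.coe_nsmul]
  have htop : n • (⊤ : WithTop ℝ) = ⊤ := by
    obtain ⟨k, rfl⟩ := Nat.exists_eq_succ_of_ne_zero hn
    rw [succ_nsmul, add_top]
  induction x with
  | top =>
    induction y with
    | top => rfl
    | coe y => rw [htop, key] at h; exact absurd h.symm WithTop.coe_ne_top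
  | coe x =>
    induction y with
    | top => rw [htop, key] at h; exact absurd h WithTop.coe_ne_top
    | coe y =>
      rw [key, key, WithTop.coe_inj] at h
      rw [(nsmul_right_injective hn : Function.Injective fun z : ℝ => n • z) h]

theorem withTop_nsmul_surjective {n : ℕ} (hn : n ≠ 0) (x : WithTop ℝ) : ∃ y, n • y = x := by
  induction x with
  | top =>
    obtain ⟨k, rfl⟩ := Nat.exists_eq_succ_of_ne_zero hn
    exact ⟨⊤, by rw [succ_nsmul, add_top]⟩
  | coe x =>
    refine ⟨((x / n : ℝ) : WithTop ℝ), ?_⟩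
    rw [← WithTop.coe_nsmul, nsmul_eq_mul, mul_div_cancel₀]
    exact_mod_cast hn

/-- Every semigroup morphism `Γ → ℝ ∪ {∞}` extends uniquely to `sat(Γ) = σ̌ ∩ M`. -/
theorem existsUnique_extension (w : Γ →+ WithTop ℝ) :
    ∃! u : LinearVariety Γ, ∀ a, u (toSaturation Γ a) = w a := by
  have hinj : Function.Injective (GrothendieckAddGroup.of : Γ →+ GrothendieckAddGroup Γ) :=
    GrothendieckAddGroup.of_injective
  have hsat : ∀ m : saturation Γ, ∃ n : ℕ, n ≠ 0 ∧ ∃ a : Γ, n • m = toSaturation Γ a := by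
    rintro ⟨m, n, hn, a, h⟩
    exact ⟨n, hn, a, Subtype.ext h⟩
  have hinj' : Function.Injective (toSaturation Γ) := fun a b h =>
    hinj (congrArg Subtype.val h)
  choose n hn a ha using hsat
  choose f hf using fun m => withTop_nsmul_surjective (hn m) (w (a m))
  have key : ∀ (m : saturation Γ) (k : ℕ) (b : Γ), k • m = toSaturation Γ b → k • f m = w b := by
    intro m k b hb
    apply withTop_nsmul_injective (hn m)
    have : k • a m = n m • b := by
      apply hinj'
      rw [map_nsmul, map_nsmul, ← ha, ← hb, smul_smul, smul_smul, mul_comm]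
    rw [smul_smul, mul_comm, mul_smul, hf, ← map_nsmul, ← map_nsmul, this]
  refine ⟨{ toFun := f, map_zero' := ?_, map_add' := ?_ }, ?_, ?_⟩
  · simpa using key 0 1 0 (by simp)
  · intro x y
    apply withTop_nsmul_injective (mul_ne_zero (hn x) (hn y))
    rw [key (x + y) (n x * n y) (n y • a x + n x • a y), map_add, map_nsmul, map_nsmul, ← hf, ← hf,
      smul_add, smul_smul, smul_smul, mul_comm]
    rw [map_add, map_nsmul, map_nsmul, ← ha, ← ha, smul_add, smul_smul, smul_smul, mul_comm]
  · intro b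
    simpa using key (toSaturation Γ b) 1 b (one_smul _ _)
  · intro u hu
    ext1 m
    apply withTop_nsmul_injective (hn m)
    change _ = n m • f m
    rw [hf, ← map_nsmul, ha, hu]

/-- The point of `L(σ, N)` given by a semigroup morphism `Γ → ℝ ∪ {∞}`. -/
def LinearVariety.ofHom (w : Γ →+ WithTop ℝ) : LinearVariety Γ :=
  (existsUnique_extension w).choose

theorem LinearVariety.ofHom_apply (w : Γ →+ WithTop ℝ) (a : Γ) :
    LinearVariety.ofHom w (toSaturation Γ a) = w a :=
  (existsUnique_extension w).choose_spec.1 a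

end LinearVariety

/-! ### Local tropicalization of a semigroup morphism `γ : Γ → (R, ·)` -/

section Tropicalization

variable {Γ R : Type*} [AddCancelCommMonoid Γ] [CommRing R]

/-- The composite `v ∘ γ : Γ → ℝ ∪ {∞}` of `γ` with a real valuation `v` of `R`. -/
def valComp (γ : Multiplicative Γ →* R) (v : AddValuation R (WithTop ℝ)) : Γ →+ WithTop ℝ where
  toFun a := v (γ (Multiplicative.ofAdd a))
  map_zero' := by rw [ofAdd_zero, map_one, v.map_one]
  map_add' a b := by rw [ofAdd_add, map_mul, v.map_mul]

/-- The map `Φ_γ` from the real valuations of `R` to `L(σ, N)`. -/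
def tropMap (γ : Multiplicative Γ →* R) (v : AddValuation R (WithTop ℝ)) : LinearVariety Γ :=
  LinearVariety.ofHom (valComp γ v)

/-- The real valuations that are nonnegative on `R` (they have a center on `Spec R`). -/
def nonnegValuations (R : Type*) [CommRing R] : Set (AddValuation R (WithTop ℝ)) :=
  {v | ∀ f, 0 ≤ v f}

/-- The local valuations of a local ring `R`: nonnegative on `R` and positive on the maximal
ideal, i.e. on the non-units. -/
def localValuations (R : Type*) [CommRing R] : Set (AddValuation R (WithTop ℝ)) :=
  {v | (∀ f, 0 ≤ v f) ∧ ∀ f ∈ nonunits R, 0 < v f}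

/-- The local nonnegative tropicalization of `γ`. -/
def nonnegTrop (γ : Multiplicative Γ →* R) : Set (LinearVariety Γ) :=
  tropMap γ '' nonnegValuations R

/-- The local positive tropicalization of `γ`: the closure, inside `σ̄°`, of the image of the
local valuations. -/
def posTrop (γ : Multiplicative Γ →* R) : Set (LinearVariety Γ) :=
  closure (tropMap γ '' localValuations R) ∩ extendedConeInterior Γ

variable {K : Type*} [Field K] [AddMonoid.FG Γ] [Subsingleton (AddUnits Γ)]

/-- The local nonnegative tropicalization of an ideal of `K[[Γ]]`. -/
def nntrop (I : Ideal (FormalToricRing K Γ)) : Set (LinearVariety Γ) :=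
  nonnegTrop (FormalToricRing.toQuotient I)

/-- The local positive tropicalization of an ideal of `K[[Γ]]`. -/
def ptrop (I : Ideal (FormalToricRing K Γ)) : Set (LinearVariety Γ) :=
  posTrop (FormalToricRing.toQuotient I)

end Tropicalization

/-! ### The strata of `L(σ, N)` and rational PL conical subspaces -/

section PLConical

/-- A rational convex polyhedral cone in a real vector space `V` with a lattice `Λ`: a finite
intersection of half-spaces `{x | 0 ≤ φ x}` with `φ` in the dual lattice. -/
def IsRationalPolyhedralCone {V : Type*} [AddCommGroup V] [Module ℝ V] (Λ : AddSubgroup V)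
    (C : Set V) : Prop :=
  ∃ s : Finset (V →ₗ[ℝ] ℝ), (∀ φ ∈ s, ∀ x ∈ Λ, ∃ k : ℤ, φ x = k) ∧ C = {x | ∀ φ ∈ s, 0 ≤ φ x}

/-- A rational PL cone: a finite union of rational convex polyhedral cones. -/
def IsRationalPLCone {V : Type*} [AddCommGroup V] [Module ℝ V] (Λ : AddSubgroup V)
    (P : Set V) : Prop :=
  ∃ 𝒞 : Set (Set V), 𝒞.Finite ∧ (∀ C ∈ 𝒞, IsRationalPolyhedralCone Λ C) ∧ P = ⋃₀ 𝒞

variable (Γ : Type*) [AddCancelCommMonoid Γ]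

/-- The real vector space `N_ℝ = Hom(M, ℝ)`. -/
abbrev RealDual : Type _ := GrothendieckAddGroup Γ →+ ℝ

/-- The lattice `N` in `N_ℝ`: the integer valued homomorphisms. -/
def dualLattice : AddSubgroup (RealDual Γ) where
  carrier := {w | ∀ m, ∃ k : ℤ, w m = k}
  zero_mem' m := ⟨0, by simp⟩
  add_mem' := by
    intro v w hv hw m
    obtain ⟨a, ha⟩ := hv m
    obtain ⟨b, hb⟩ := hw m
    exact ⟨a + b, by simp [ha, hb]⟩
  neg_mem' := by
    intro w hw m
    obtain ⟨a, ha⟩ := hw m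
    exact ⟨-a, by simp [ha]⟩

/-- The cone `σ = σ(Γ)` of all `w ∈ N_ℝ` that are nonnegative on `Γ`. -/
def dualCone : PointedCone ℝ (RealDual Γ) where
  carrier := {w | ∀ a : Γ, 0 ≤ w (GrothendieckAddGroup.of a)}
  zero_mem' a := by simp
  add_mem' := fun hv hw a => add_nonneg (hv a) (hw a)
  smul_mem' := fun c w hw a => mul_nonneg c.2 (hw a)

variable {Γ}

/-- Evaluation of the elements of `N_ℝ` at `m ∈ M`. -/
def evalAt (m : GrothendieckAddGroup Γ) : RealDual Γ →ₗ[ℝ] ℝ where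
  toFun w := w m
  map_add' _ _ := rfl
  map_smul' _ _ := rfl

/-- The vector space `(N / N_τ)_ℝ = N_ℝ / span τ`. -/
abbrev Stratum (τ : PointedCone ℝ (RealDual Γ)) : Type _ :=
  RealDual Γ ⧸ Submodule.span ℝ (τ : Set (RealDual Γ))

/-- The lattice `N / N_τ` in `(N / N_τ)_ℝ`, i.e. the image of `N`. -/
def stratumLattice (τ : PointedCone ℝ (RealDual Γ)) : AddSubgroup (Stratum τ) :=
  (dualLattice Γ).map
    (Submodule.mkQ (Submodule.span ℝ (τ : Set (RealDual Γ)))).toAddMonoidHom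

/-- `m ∈ τ^⊥`. -/
def InPerp (τ : PointedCone ℝ (RealDual Γ)) (m : GrothendieckAddGroup Γ) : Prop :=
  ∀ w ∈ τ, w m = 0

/-- The pairing of `(N / N_τ)_ℝ` with an element `m` of `M ∩ τ^⊥`. -/
def stratumEval (τ : PointedCone ℝ (RealDual Γ)) (m : GrothendieckAddGroup Γ) (hm : InPerp τ m) :
    Stratum τ →ₗ[ℝ] ℝ :=
  Submodule.liftQ _ (evalAt m) (Submodule.span_le.2 fun w hw => hm w hw)

theorem nonneg_of_mem_dualCone {w : RealDual Γ} (hw : w ∈ dualCone Γ) (m : saturation Γ) :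
    0 ≤ w (m : GrothendieckAddGroup Γ) := by
  obtain ⟨m, n, hn, a, h⟩ := m
  have h1 : (n : ℝ) * w m = w (GrothendieckAddGroup.of a) := by
    rw [← h, map_nsmul, nsmul_eq_mul]
  have h2 : 0 ≤ (n : ℝ) * w m := h1 ▸ hw a
  exact nonneg_of_mul_nonneg_right h2 (by exact_mod_cast Nat.pos_of_ne_zero hn)

theorem inPerp_add_iff {τ : PointedCone ℝ (RealDual Γ)} (hτ : τ ≤ dualCone Γ)
    (m m' : saturation Γ) :
    InPerp τ ((m + m' : saturation Γ) : GrothendieckAddGroup Γ) ↔ InPerp τ m ∧ InPerp τ m' := by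
  refine ⟨fun h => ⟨fun w hw => ?_, fun w hw => ?_⟩, fun h w hw => ?_⟩
  · have h0 := h w hw
    rw [AddSubmonoid.coe_add, map_add] at h0
    linarith [nonneg_of_mem_dualCone (hτ hw) m, nonneg_of_mem_dualCone (hτ hw) m']
  · have h0 := h w hw
    rw [AddSubmonoid.coe_add, map_add] at h0
    linarith [nonneg_of_mem_dualCone (hτ hw) m, nonneg_of_mem_dualCone (hτ hw) m']
  · rw [AddSubmonoid.coe_add, map_add, h.1 w hw, h.2 w hw, add_zero]

open Classical in
/-- The embedding of the stratum `(N / N_τ)_ℝ` into `L(σ, N)`: a class `x` is sent to the morphism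
equal to `x` on `σ̌ ∩ M ∩ τ^⊥` and to `∞` on the rest of `σ̌ ∩ M`. -/
def stratumMap (τ : PointedCone ℝ (RealDual Γ)) (hτ : τ.IsFaceOf (dualCone Γ)) (x : Stratum τ) :
    LinearVariety Γ where
  toFun m := if h : InPerp τ m then ((stratumEval τ m h x : ℝ) : WithTop ℝ) else ⊤
  map_zero' := by
    have h : InPerp τ ((0 : saturation Γ) : GrothendieckAddGroup Γ) := fun w _ => by simp
    rw [dif_pos h]
    induction x using Submodule.Quotient.induction_on with
    | _ w => simp [stratumEval, evalAt]
  map_add' m m' := by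
    by_cases h : InPerp τ m
    · by_cases h' : InPerp τ m'
      · rw [dif_pos ((inPerp_add_iff hτ.le m m').2 ⟨h, h'⟩), dif_pos h, dif_pos h',
          ← WithTop.coe_add, WithTop.coe_inj]
        induction x using Submodule.Quotient.induction_on with
        | _ w => simp [stratumEval, evalAt]
      · rw [dif_neg h', dif_neg fun hh => h' ((inPerp_add_iff hτ.le m m').1 hh).2, add_top]
    · rw [dif_neg h, dif_neg fun hh => h ((inPerp_add_iff hτ.le m m').1 hh).1, top_add]

/-- A subset `S` of `L(σ, N)` is a rational PL conical subspace if, for every face `τ` of `σ`, its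
intersection with the stratum `(N / N_τ)_ℝ` is empty or a rational PL cone. -/
def IsRationalPLConicalSubspace (S : Set (LinearVariety Γ)) : Prop :=
  ∀ (τ : PointedCone ℝ (RealDual Γ)) (hτ : τ.IsFaceOf (dualCone Γ)),
    stratumMap τ hτ ⁻¹' S = ∅ ∨ IsRationalPLCone (stratumLattice τ) (stratumMap τ hτ ⁻¹' S)

/-- Rational PL conical subspaces of a subset `A` of `L(σ, N)`, such as `σ̄` or `σ̄°`: the
intersections with `A` of the rational PL conical subspaces of `L(σ, N)`. When `A` is itself a
rational PL conical subspace, like `σ̄`, these are exactly the rational PL conical subspaces of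
`L(σ, N)` contained in `A`. -/
def IsRationalPLConicalSubspaceIn (A S : Set (LinearVariety Γ)) : Prop :=
  ∃ T : Set (LinearVariety Γ), IsRationalPLConicalSubspace T ∧ S = T ∩ A

end PLConical

end

noncomputable section

/-! ### Dickson's lemma for finitely generated commutative monoids -/

section Dickson

variable {Γ : Type*} [AddCancelCommMonoid Γ] [AddMonoid.FG Γ]

/-! The first pillar is a description without valuations, `mem_nntrop_iff`: a nonnegative point `u`
lies in `nntrop I` exactly when no `f ∈ I` has a monomial as its initial form for the weight `u`.
Such an `f` would give one monomial of the quotient two different values. Conversely, its absence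
says exactly that the quotient weight seminorm, localized at the monomials of finite weight, takes
the value 1 at 1. Smoothing and Zorn's lemma then yield a multiplicative seminorm below it, as in
Berkovich's nonemptiness argument, with the same values on monomials; its `-log` is the required
valuation.

The second pillar is finiteness, `exists_finite_cones`. On a stratum the weights depend linearly on
a parameter. An ultrafilter of monomial free weights defines a generic order with a finite standard
basis. The weights inducing the same initial forms on this basis form a rational half-open cone,
which belongs to the ultrafilter and, by a division argument, consists of monomial free weights
(`exists_halfOpenCone_subset`). Compactness of the space of ultrafilters leaves finitely many such
cones. Being monomial free is a closed condition, so each nonempty cone may be replaced by its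
closure.

Dickson's lemma reduces infinite supports to finite sets throughout. For the positive
tropicalization (`ptrop_eq`), `nntrop I` is closed, and a nonnegative valuation lying over `σ̄°` is
automatically local, because series with nonzero constant term are units. -/

theorem exists_surjective_from_pi_nat (Γ : Type*) [AddCancelCommMonoid Γ] [AddMonoid.FG Γ] :
    ∃ (n : ℕ) (φ : (Fin n → ℕ) →+ Γ), Function.Surjective φ := by
  have hfin : Module.Finite ℕ Γ := Module.Finite.iff_addMonoid_fg.2 inferInstance
  obtain ⟨n, φ, hφ⟩ := Module.Finite.exists_fin' ℕ Γ
  exact ⟨n, φ.toAddMonoidHom, hφ⟩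

theorem wellQuasiOrdered_exists_add (Γ : Type*) [AddCancelCommMonoid Γ] [AddMonoid.FG Γ] :
    WellQuasiOrdered fun a b : Γ => ∃ c, b = a + c := by
  obtain ⟨n, φ, hφ⟩ := exists_surjective_from_pi_nat Γ
  intro e
  choose g hg using hφ
  obtain ⟨i, j, hij, hle⟩ := wellQuasiOrdered_le fun k => g (e k)
  obtain ⟨c, hc⟩ := exists_add_of_le hle
  exact ⟨i, j, hij, φ c, by rw [← hg (e j), ← hg (e i), ← map_add]; exact congrArg φ hc⟩

/-- Every subset of `Γ` is contained in the ideal generated by a finite subset of it. -/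
theorem exists_finset_generating (A : Set Γ) :
    ∃ B : Finset Γ, ↑B ⊆ A ∧ ∀ a ∈ A, ∃ b ∈ B, ∃ c, a = b + c := by
  classical
  obtain ⟨n, φ, hφ⟩ := exists_surjective_from_pi_nat Γ
  -- Minimal elements form an antichain in `ℕ^n`, hence a finite set; it is pushed forward to `Γ`.
  have hfin : {x | Minimal (· ∈ φ ⁻¹' A) x}.Finite :=
    WellQuasiOrderedLE.finite_of_isAntichain (setOfPred_minimal_antichain _)
  refine ⟨hfin.toFinset.image φ, ?_, ?_⟩
  · intro b hb
    simp only [Finset.coe_image, Set.Finite.coe_toFinset, Set.mem_image] at hb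
    obtain ⟨x, hx, rfl⟩ := hb
    exact hx.prop
  · intro a ha
    obtain ⟨x, rfl⟩ := hφ a
    obtain ⟨y, hyx, hy⟩ := exists_minimal_le_of_wellFoundedLT (· ∈ φ ⁻¹' A) x ha
    obtain ⟨c, rfl⟩ := exists_add_of_le hyx
    exact ⟨φ y, Finset.mem_image_of_mem _ (hfin.mem_toFinset.2 hy), φ c, map_add _ _ _⟩

/-- In an infinite descending sequence, Dickson's lemma finds a later term of the form `a + c` with
`a` an earlier term, and transitivity puts it below `a`. -/
theorem wellFounded_of_not_add_lt (r : Γ → Γ → Prop) (htrans : ∀ a b c, r a b → r b c → r a c)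
    (h : ∀ a c, ¬ r (a + c) a) : WellFounded r := by
  have : IsStrictOrder Γ r :=
    { irrefl := fun a ha => h a 0 (by rwa [add_zero])
      trans := htrans }
  rw [RelEmbedding.wellFounded_iff_isEmpty]
  refine ⟨fun f => ?_⟩
  obtain ⟨i, j, hij, c, hc⟩ := wellQuasiOrdered_exists_add Γ f
  exact h (f i) c (hc ▸ f.map_rel_iff.2 hij)

end Dickson

/-! ### Monomial orders on pointed affine semigroups -/

section MonomialOrder

/-- Every pointed submonoid of a torsion-free commutative group is contained in a pointed submonoid
which contains `x` or `-x` for every `x`. -/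
theorem exists_isTotal_pointed_submonoid {G : Type*} [AddCommGroup G] [IsAddTorsionFree G]
    (P₀ : AddSubmonoid G) (hP₀ : ∀ x ∈ P₀, -x ∈ P₀ → x = 0) :
    ∃ P : AddSubmonoid G, P₀ ≤ P ∧ (∀ x ∈ P, -x ∈ P → x = 0) ∧ ∀ x, x ∈ P ∨ -x ∈ P := by
  obtain ⟨P, hle, hmax⟩ := zorn_le_nonempty₀ {P : AddSubmonoid G | ∀ x ∈ P, -x ∈ P → x = 0} (by
    intro c hc hchain y hy
    refine ⟨sSup c, ?_, fun z hz => le_sSup hz⟩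
    intro x hx hx'
    rw [AddSubmonoid.mem_sSup_of_directedOn ⟨y, hy⟩ hchain.directedOn] at hx hx'
    obtain ⟨P, hP, hxP⟩ := hx
    obtain ⟨Q, hQ, hxQ⟩ := hx'
    rcases hchain.total hP hQ with hPQ | hPQ
    · exact hc hQ x (hPQ hxP) hxQ
    · exact hc hP x hxP (hPQ hxQ)) P₀ hP₀
  -- Adjoining `x` to a maximal pointed `P` must destroy pointedness, which forces a negative
  -- multiple of `x` into `P`.
  have hadd : ∀ x, x ∉ P → ∃ n : ℕ, n ≠ 0 ∧ -(n • x) ∈ P := by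
    intro x hx
    by_contra! hcon
    have hQ : P ⊔ AddSubmonoid.multiples x ∈
        {P : AddSubmonoid G | ∀ x ∈ P, -x ∈ P → x = 0} := by
      intro z hz hz'
      obtain ⟨p, hp, _, ⟨n, rfl⟩, rfl⟩ := AddSubmonoid.mem_sup.1 hz
      obtain ⟨q, hq, _, ⟨k, rfl⟩, h⟩ := AddSubmonoid.mem_sup.1 hz'
      have h1 : -((n + k) • x) = p + q := by
        rw [eq_neg_iff_add_eq_zero] at h
        rw [add_smul, neg_eq_iff_add_eq_zero, ← h]
        abel
      have h2 : n + k = 0 := by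
        by_contra h0
        exact hcon _ h0 (h1 ▸ P.add_mem hp hq)
      obtain ⟨rfl, rfl⟩ := Nat.add_eq_zero_iff.1 h2
      simp only [zero_smul, add_zero] at h ⊢
      exact hmax.prop p hp (h ▸ hq)
    have := hmax.le_of_ge hQ le_sup_left
    exact hx (this ((le_sup_right : _ ≤ P ⊔ AddSubmonoid.multiples x)
      (AddSubmonoid.mem_multiples x)))
  refine ⟨P, hle, hmax.prop, fun x => ?_⟩
  by_contra! hx
  obtain ⟨n, hn, hnx⟩ := hadd x hx.1
  obtain ⟨k, hk, hkx⟩ := hadd (-x) hx.2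
  rw [smul_neg, neg_neg] at hkx
  have h1 : (k * n) • x ∈ P := by
    rw [mul_comm, mul_smul]; exact P.nsmul_mem hkx n
  have h2 : -((k * n) • x) ∈ P := by
    rw [mul_smul, ← smul_neg]; exact P.nsmul_mem hnx k
  have h3 := hmax.prop _ h1 h2
  rw [smul_eq_zero_iff_right (mul_ne_zero hk hn)] at h3
  exact hx.1 (h3 ▸ P.zero_mem)

/-- A monomial order: a strict total order, compatible with addition, for which `a + c` is never
smaller than `a`. -/
structure IsMonomialOrder {Γ : Type*} [AddCommMonoid Γ] (r : Γ → Γ → Prop) : Prop where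
  trans : ∀ a b c, r a b → r b c → r a c
  trichotomous : ∀ a b, a ≠ b → r a b ∨ r b a
  add_right : ∀ a b c, r a b → r (a + c) (b + c)
  not_add_lt : ∀ a c, ¬ r (a + c) a

/-- Pointedness of `Γ` makes its image in the Grothendieck group pointed. A total pointed submonoid
containing it is the positive cone of a translation invariant total order in which `Γ` is
nonnegative. -/
theorem exists_isMonomialOrder (Γ : Type*) [AddCancelCommMonoid Γ] [IsAddTorsionFree Γ]
    [Subsingleton (AddUnits Γ)] : ∃ r : Γ → Γ → Prop, IsMonomialOrder r := by
  have hinj : Function.Injective (GrothendieckAddGroup.of : Γ →+ GrothendieckAddGroup Γ) :=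
    GrothendieckAddGroup.of_injective
  obtain ⟨P, hle, hpt, htot⟩ := exists_isTotal_pointed_submonoid
    (AddMonoidHom.mrange (GrothendieckAddGroup.of : Γ →+ GrothendieckAddGroup Γ)) (by
      rintro _ ⟨a, rfl⟩ ⟨b, hb⟩
      have h : a + b = 0 := hinj (by rw [map_add, map_zero, hb, add_neg_cancel])
      have := congrArg AddUnits.val (Subsingleton.elim
        (⟨a, b, h, by rw [add_comm]; exact h⟩ : AddUnits Γ) 0)
      change a = 0 at this
      rw [this, map_zero])
  refine ⟨fun a b => a ≠ b ∧ GrothendieckAddGroup.of b - GrothendieckAddGroup.of a ∈ P, ?_⟩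
  have hanti : ∀ a b : Γ, GrothendieckAddGroup.of b - GrothendieckAddGroup.of a ∈ P →
      GrothendieckAddGroup.of a - GrothendieckAddGroup.of b ∈ P → a = b := fun a b h h' =>
    (hinj (sub_eq_zero.1 (hpt _ h (by rwa [neg_sub])))).symm
  refine ⟨?_, ?_, ?_, ?_⟩
  · rintro a b c ⟨hab, h⟩ ⟨hbc, h'⟩
    have h'' := P.add_mem h' h
    rw [sub_add_sub_cancel] at h''
    refine ⟨?_, h''⟩
    rintro rfl
    exact hab (hanti a b h h')
  · intro a b hab
    rcases htot (GrothendieckAddGroup.of b - GrothendieckAddGroup.of a) with h | h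
    · exact Or.inl ⟨hab, h⟩
    · exact Or.inr ⟨hab.symm, by rwa [neg_sub] at h⟩
  · rintro a b c ⟨hab, h⟩
    exact ⟨fun h => hab (add_right_cancel h), by rwa [map_add, map_add, add_sub_add_right_eq_sub]⟩
  · rintro a c ⟨hne, h⟩
    refine hne (hanti _ _ h ?_)
    rw [map_add, add_sub_cancel_left]
    exact hle ⟨c, rfl⟩

end MonomialOrder

/-! ### Products of series -/

namespace FormalToricRing

variable {K Γ : Type*} [Field K] [AddCancelCommMonoid Γ] [AddMonoid.FG Γ]
  [Subsingleton (AddUnits Γ)]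

theorem sum_apply {ι : Type*} (s : Finset ι) (f : ι → FormalToricRing K Γ) (m : Γ) :
    (∑ i ∈ s, f i) m = ∑ i ∈ s, f i m :=
  map_sum (⟨⟨fun f : FormalToricRing K Γ => f m, rfl⟩, fun _ _ => rfl⟩ :
    FormalToricRing K Γ →+ K) f s

theorem sub_apply (f g : FormalToricRing K Γ) (m : Γ) : (f - g) m = f m - g m := rfl

theorem exists_of_mul_apply_ne_zero {f g : FormalToricRing K Γ} {m : Γ} (h : (f * g) m ≠ 0) :
    ∃ a b, a + b = m ∧ f a ≠ 0 ∧ g b ≠ 0 := by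
  rw [mul_apply] at h
  obtain ⟨p, hp, hne⟩ := Finset.exists_ne_zero_of_sum_ne_zero h
  exact ⟨p.1, p.2, mem_pairs.1 hp, left_ne_zero_of_mul hne, right_ne_zero_of_mul hne⟩

theorem monomial_mul_apply_add (a c : Γ) (f : FormalToricRing K Γ) :
    (monomial a * f : FormalToricRing K Γ) (a + c) = f c := by
  classical
  rw [mul_apply, Finset.sum_eq_single (a, c)]
  · simp [monomial_apply]
  · rintro ⟨b, d⟩ hbd hne
    rw [mem_pairs] at hbd
    have : b ≠ a := by
      rintro rfl
      exact hne (Prod.ext rfl (add_left_cancel hbd))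
    simp [monomial_apply, this]
  · simp [mem_pairs]

theorem exists_of_monomial_mul_apply_ne_zero {a m : Γ} {f : FormalToricRing K Γ}
    (h : (monomial a * f : FormalToricRing K Γ) m ≠ 0) : ∃ c, m = a + c ∧ f c ≠ 0 := by
  classical
  obtain ⟨b, c, rfl, hb, hc⟩ := exists_of_mul_apply_ne_zero h
  rw [monomial_apply] at hb
  obtain rfl : b = a := by by_contra hne; exact hb (if_neg hne)
  exact ⟨c, rfl, hc⟩

/-- A series whose support is in the ideal of `Γ` generated by a finite set `B` is a combination of
the monomials with exponents in `B`. -/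
theorem exists_eq_sum_monomial_mul (F : FormalToricRing K Γ) (B : Finset Γ)
    (hB : ∀ m, F m ≠ 0 → ∃ b ∈ B, ∃ c, m = b + c) :
    ∃ h : Γ → FormalToricRing K Γ, F = ∑ b ∈ B, monomial b * h b := by
  classical
  have : ∀ m, ∃ b, F m ≠ 0 → b ∈ B ∧ ∃ c, m = b + c := fun m => by
    by_cases hm : F m = 0
    · exact ⟨0, fun h => absurd hm h⟩
    · obtain ⟨b, hb, hc⟩ := hB m hm
      exact ⟨b, fun _ => ⟨hb, hc⟩⟩
  choose β hβ using this
  -- Each support exponent is assigned to a single `β m ∈ B`, so no term of `F` is counted twice.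
  let h : Γ → FormalToricRing K Γ := fun b q => if β (b + q) = b then F (b + q) else 0
  refine ⟨h, ?_⟩
  funext m
  rw [sum_apply]
  by_cases hm : F m = 0
  · rw [hm, Finset.sum_eq_zero]
    intro b _
    by_contra hne
    obtain ⟨c, rfl, hc⟩ := exists_of_monomial_mul_apply_ne_zero hne
    simp [h, hm] at hc
  · obtain ⟨hb, c, hc⟩ := hβ m hm
    rw [Finset.sum_eq_single (β m)]
    · have : h (β m) c = F m := by simp only [h, ← hc, if_true]
      have key := monomial_mul_apply_add (β m) c (h (β m))
      rw [← hc] at key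
      exact (key.trans this).symm
    · intro b _ hne
      by_contra h0
      obtain ⟨d, hd, hd0⟩ := exists_of_monomial_mul_apply_ne_zero h0
      exact hd0 (if_neg fun h' => hne (by rw [hd, h']))
    · exact fun h' => absurd hb h'

end FormalToricRing

/-! ### Multiplicative seminorms below a submultiplicative one -/

section MinimalSeminorm

open Filter Topology

variable {R : Type*} [CommRing R]

/-- `q` is a power-multiplicative nonarchimedean ring seminorm such that each `x ∈ X` is
multiplicative with value `a x`. -/
structure IsPowMulSeminorm (X : Set R) (a q : R → ℝ) : Prop where
  nonneg : ∀ x, 0 ≤ q x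
  zero : q 0 = 0
  one : q 1 = 1
  neg : ∀ x, q (-x) = q x
  add_le : ∀ x y, q (x + y) ≤ max (q x) (q y)
  mul_le : ∀ x y, q (x * y) ≤ q x * q y
  pow : IsPowMul q
  const_mul : ∀ x ∈ X, ∀ y, q (x * y) = a x * q y

namespace IsPowMulSeminorm

variable {X : Set R} {a q : R → ℝ}

def toRingSeminorm (h : IsPowMulSeminorm X a q) : RingSeminorm R where
  toFun := q
  map_zero' := h.zero
  add_le' x y := (h.add_le x y).trans (max_le_add_of_nonneg (h.nonneg x) (h.nonneg y))
  neg' := h.neg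
  mul_le' := h.mul_le

theorem of_ringSeminorm (p : RingSeminorm R) (h1 : p 1 = 1) (hna : IsNonarchimedean p)
    (hpow : IsPowMul p) (hX : ∀ x ∈ X, ∀ y, p (x * y) = a x * p y) :
    IsPowMulSeminorm X a p :=
  ⟨apply_nonneg p, map_zero p, h1, map_neg_eq_map p, hna, map_mul_le_mul p, hpow, hX⟩

/-- The infimum of a chain of power-multiplicative seminorms. -/
theorem iInf_chain {c : Set (R → ℝ)} (hc : ∀ q ∈ c, IsPowMulSeminorm X a q)
    (hchain : IsChain (· ≤ ·) c) (hne : c.Nonempty) :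
    IsPowMulSeminorm X a fun x => ⨅ q : c, (q : R → ℝ) x := by
  have : Nonempty c := hne.to_subtype
  -- In the reversed order the chain is directed, so the infimum is a limit along `atTop` and every
  -- axiom passes to the limit.
  have : Nonempty (c)ᵒᵈ := this
  have : IsDirectedOrder (c)ᵒᵈ := ⟨fun p q => by
    rcases hchain.total p.ofDual.2 q.ofDual.2 with h | h
    · exact ⟨p, le_rfl, h⟩
    · exact ⟨q, h, le_rfl⟩⟩
  have hlim : ∀ x, Tendsto (fun q : (c)ᵒᵈ => (q.ofDual : R → ℝ) x) atTop
      (𝓝 (⨅ q : c, (q : R → ℝ) x)) := fun x =>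
    tendsto_atTop_ciInf (ι := (c)ᵒᵈ) (f := fun q => (q.ofDual : R → ℝ) x)
      (fun p q h => (show (q.ofDual : R → ℝ) ≤ p.ofDual from h) x)
      ⟨0, by rintro _ ⟨q, rfl⟩; exact (hc _ q.ofDual.2).nonneg x⟩
  refine ⟨?_, ?_, ?_, ?_, ?_, ?_, ?_, ?_⟩
  · exact fun x => ge_of_tendsto' (hlim x) fun q => (hc _ q.ofDual.2).nonneg x
  · refine tendsto_nhds_unique (hlim 0) ?_
    simp only [fun q : (c)ᵒᵈ => (hc _ q.ofDual.2).zero]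
    exact tendsto_const_nhds
  · refine tendsto_nhds_unique (hlim 1) ?_
    simp only [fun q : (c)ᵒᵈ => (hc _ q.ofDual.2).one]
    exact tendsto_const_nhds
  · intro x
    refine tendsto_nhds_unique (hlim (-x)) ?_
    simp only [fun q : (c)ᵒᵈ => (hc _ q.ofDual.2).neg]
    exact hlim x
  · exact fun x y => le_of_tendsto_of_tendsto' (hlim (x + y)) ((hlim x).max (hlim y))
      fun q => (hc _ q.ofDual.2).add_le x y
  · exact fun x y => le_of_tendsto_of_tendsto' (hlim (x * y)) ((hlim x).mul (hlim y))
      fun q => (hc _ q.ofDual.2).mul_le x y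
  · intro x n hn
    refine tendsto_nhds_unique (hlim (x ^ n)) ?_
    simp only [fun q : (c)ᵒᵈ => (hc _ q.ofDual.2).pow x hn]
    exact (hlim x).pow n
  · intro x hx y
    refine tendsto_nhds_unique (hlim (x * y)) ?_
    simp only [fun q : (c)ᵒᵈ => (hc _ q.ofDual.2).const_mul x hx]
    exact (hlim y).const_mul _

theorem exists_minimal_le (h : IsPowMulSeminorm X a q) :
    ∃ p ≤ q, Minimal (IsPowMulSeminorm X a) p := by
  obtain ⟨p, hle, hp⟩ := zorn_le_nonempty₀ (α := (R → ℝ)ᵒᵈ)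
    {p | IsPowMulSeminorm X a p.ofDual} (by
      intro c hc hchain y hy
      let c' : Set (R → ℝ) := OrderDual.ofDual '' c
      have hc' : ∀ q ∈ c', IsPowMulSeminorm X a q := by
        rintro _ ⟨q, hq, rfl⟩
        exact hc hq
      have hchain' : IsChain (· ≤ ·) c' := by
        rintro _ ⟨p, hp, rfl⟩ _ ⟨q, hq, rfl⟩ _
        exact (hchain.total hp hq).symm
      refine ⟨OrderDual.toDual fun x => ⨅ q : c', (q : R → ℝ) x,
        iInf_chain hc' hchain' ⟨_, y, hy, rfl⟩, fun z hz x => ?_⟩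
      exact ciInf_le (f := fun q : c' => (q : R → ℝ) x)
        ⟨0, by rintro _ ⟨q, rfl⟩; exact (hc' _ q.2).nonneg x⟩ ⟨_, z, hz, rfl⟩)
    (OrderDual.toDual q) h
  exact ⟨p.ofDual, hle, hp.prop, fun r hr hrp => hp.le_of_ge (y := OrderDual.toDual r) hr hrp⟩

/-- A minimal power-multiplicative seminorm is multiplicative. -/
theorem map_mul_of_minimal (h : Minimal (IsPowMulSeminorm X a) q) (x y : R) :
    q (x * y) = q x * q y := by
  by_cases hx : q x = 0
  · rw [hx, zero_mul]
    refine le_antisymm ((h.prop.mul_le x y).trans_eq (by rw [hx, zero_mul])) (h.prop.nonneg _)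
  -- The seminorm `lim q (x ^ n * y) / q x ^ n` is in the same class, lies below `q`, and has `x` as
  -- a multiplicative element; minimality identifies it with `q`.
  · let f := h.prop.toRingSeminorm
    have h1 : f 1 ≤ 1 := h.prop.one.le
    have hc : f x ≠ 0 := hx
    have hpm : IsPowMul f := h.prop.pow
    have hle : ∀ z, seminormFromConst' x f z ≤ q z := seminormFromConst_le_seminorm h1 hc hpm
    have hX : ∀ z ∈ X, ∀ y, f (z * y) = f z * f y := fun z hz y => by
      have h2 : q (z * 1) = a z * q 1 := h.prop.const_mul z hz 1
      rw [mul_one, h.prop.one, mul_one] at h2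
      change q (z * y) = q z * q y
      rw [h2, h.prop.const_mul z hz]
    have hmem : IsPowMulSeminorm X a (seminormFromConst h1 hc hpm) := by
      refine of_ringSeminorm _ (seminormFromConst_one h1 hc hpm)
        (seminormFromConst_isNonarchimedean h1 hc hpm h.prop.add_le)
        (seminormFromConst_isPowMul h1 hc hpm) fun z hz y => ?_
      have h2 : q (z * 1) = a z * q 1 := h.prop.const_mul z hz 1
      rw [mul_one, h.prop.one, mul_one] at h2
      rw [seminormFromConst_def, seminormFromConst_def,
        seminormFromConst_isMul_of_isMul h1 hc hpm (hX z hz),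
        seminormFromConst_apply_of_isMul h1 hc hpm (hX z hz), ← h2]
      rfl
    have heq : ∀ z, seminormFromConst' x f z = q z := fun z =>
      le_antisymm (hle z) (h.le_of_le hmem hle z)
    have := seminormFromConst_const_mul h1 hc hpm y
    rwa [heq, heq, heq] at this

end IsPowMulSeminorm

/-- Below a nonarchimedean ring seminorm `N` with `N 1 = 1` there is a multiplicative one which
agrees with `N` on the elements that are multiplicative for `N`. -/
theorem exists_multiplicative_seminorm_le (N : RingSeminorm R) (h1 : N 1 = 1)
    (hna : IsNonarchimedean N) :
    ∃ q : R → ℝ, (∀ x, 0 ≤ q x) ∧ q 0 = 0 ∧ q 1 = 1 ∧ (∀ x y, q (x + y) ≤ max (q x) (q y)) ∧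
      (∀ x y, q (x * y) = q x * q y) ∧ (∀ x, q x ≤ N x) ∧
      ∀ x, (∀ y, N (x * y) = N x * N y) → q x = N x := by
  let X : Set R := {x | ∀ y, N (x * y) = N x * N y}
  -- Smoothing makes `N` power-multiplicative without changing it on `X`. The field `const_mul`
  -- preserves these values on passing to a minimal seminorm.
  have hs : IsPowMulSeminorm X N (smoothingSeminorm N h1.le hna) := by
    refine .of_ringSeminorm _ ?_ (isNonarchimedean_smoothingFun N h1.le hna)
      (isPowMul_smoothingFun N h1.le) fun x hx y => ?_
    · rw [smoothingSeminorm_apply_of_map_mul_eq_mul N h1.le hna (fun y => by rw [one_mul, h1,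
        one_mul]), h1]
    · rw [smoothingSeminorm_of_mul N h1.le hna hx,
        smoothingSeminorm_apply_of_map_mul_eq_mul N h1.le hna hx]
  obtain ⟨q, hle, hq⟩ := hs.exists_minimal_le
  refine ⟨q, hq.prop.nonneg, hq.prop.zero, hq.prop.one, hq.prop.add_le,
    IsPowMulSeminorm.map_mul_of_minimal hq, fun x => (hle x).trans (smoothingFun_le_self N x),
    fun x hx => ?_⟩
  have := hq.prop.const_mul x hx 1
  rwa [mul_one, hq.prop.one, mul_one] at this

end MinimalSeminorm

/-! ### Real valuations with prescribed values on the monomials -/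

section Existence

open FormalToricRing

variable {K Γ : Type*} [Field K] [AddCancelCommMonoid Γ] [AddMonoid.FG Γ]
  [Subsingleton (AddUnits Γ)]

/-- Some element of `I` is the sum of a monomial of finite weight and a series of strictly larger
weight; that is, the initial ideal of `I` with respect to `w` contains a monomial. -/
def HasMonomialInitialForm (I : Ideal (FormalToricRing K Γ)) (w : Γ → WithTop ℝ) : Prop :=
  ∃ f ∈ I, ∃ m, w m ≠ ⊤ ∧ f m = 1 ∧ ∀ m', m' ≠ m → f m' ≠ 0 → w m < w m'

/-- A valuation which is nonnegative takes on a series a value at least the minimum of its values on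
the monomials of the support. -/
theorem lt_valuation_of_forall_lt {I : Ideal (FormalToricRing K Γ)}
    {v : AddValuation (FormalToricRing K Γ ⧸ I) (WithTop ℝ)} (hv : v ∈ nonnegValuations _)
    {c : WithTop ℝ} {F : FormalToricRing K Γ} (hc : c ≠ ⊤)
    (h : ∀ m, F m ≠ 0 → c < valComp (toQuotient I) v m) :
    c < v (Ideal.Quotient.mk I F) := by
  -- No compatibility of `v` with infinite sums is available, so `F` is first rewritten as a finite
  -- combination of monomials.
  obtain ⟨B, hBF, hB⟩ := exists_finset_generating {m | F m ≠ 0}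
  obtain ⟨g, hg⟩ := exists_eq_sum_monomial_mul F B hB
  rw [hg, map_sum]
  refine v.map_lt_sum hc fun b hb => ?_
  rw [map_mul, v.map_mul]
  exact (h b (hBF hb)).trans_le (le_add_of_nonneg_right (hv _))

/-- Modulo `I` the monomial `χ^m` equals minus the tail of `f`, whose value is strictly larger. -/
theorem not_hasMonomialInitialForm_of_valuation {I : Ideal (FormalToricRing K Γ)}
    {v : AddValuation (FormalToricRing K Γ ⧸ I) (WithTop ℝ)} (hv : v ∈ nonnegValuations _) :
    ¬ HasMonomialInitialForm I (valComp (toQuotient I) v) := by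
  classical
  rintro ⟨f, hf, m, hm, hfm, hlt⟩
  have h1 : valComp (toQuotient I) v m < v (Ideal.Quotient.mk I (f - monomial m)) := by
    refine lt_valuation_of_forall_lt hv hm fun m' hm' => ?_
    rw [FormalToricRing.sub_apply, monomial_apply] at hm'
    by_cases h : m' = m
    · rw [h, if_pos rfl, hfm, sub_self] at hm'
      exact absurd rfl hm'
    · rw [if_neg h, sub_zero] at hm'
      exact hlt m' h hm'
  rw [map_sub, Ideal.Quotient.eq_zero_iff_mem.2 hf, zero_sub, v.map_neg] at h1
  exact lt_irrefl _ h1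

/-- The order reversing exponential `x ↦ exp (-x)`. -/
def expNeg : WithTop ℝ → ℝ
  | ⊤ => 0
  | (x : ℝ) => Real.exp (-x)

theorem expNeg_top : expNeg ⊤ = 0 := rfl

theorem expNeg_coe (x : ℝ) : expNeg x = Real.exp (-x) := rfl

theorem expNeg_add (x y : WithTop ℝ) : expNeg (x + y) = expNeg x * expNeg y := by
  induction x with
  | top => simp [expNeg_top]
  | coe x =>
    induction y with
    | top => simp [expNeg_top]
    | coe y => rw [← WithTop.coe_add, expNeg_coe, expNeg_coe, expNeg_coe, ← Real.exp_add]; ring_nf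

theorem expNeg_lt {x y : WithTop ℝ} : expNeg x < expNeg y ↔ y < x := by
  induction x with
  | top =>
    induction y with
    | top => simp
    | coe y => simp [expNeg_top, expNeg_coe, Real.exp_pos]
  | coe x =>
    induction y with
    | top => simp [expNeg_top, expNeg_coe, (Real.exp_pos _).le]
    | coe y => simp [expNeg_coe]

theorem expNeg_nonneg (x : WithTop ℝ) : 0 ≤ expNeg x := by
  rw [← expNeg_top, ← not_lt, expNeg_lt]
  exact not_top_lt

theorem expNeg_pos {x : WithTop ℝ} : 0 < expNeg x ↔ x ≠ ⊤ := by
  rw [← expNeg_top, expNeg_lt, lt_top_iff_ne_top]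

theorem expNeg_zero : expNeg 0 = 1 := by
  rw [← WithTop.coe_zero, expNeg_coe, neg_zero, Real.exp_zero]

theorem expNeg_le_one {x : WithTop ℝ} (hx : 0 ≤ x) : expNeg x ≤ 1 := by
  rw [← expNeg_zero, ← not_lt, expNeg_lt]
  exact hx.not_gt

theorem expNeg_injective : Function.Injective expNeg := fun x y h => by
  rcases lt_trichotomy x y with h' | h' | h'
  · exact absurd h (expNeg_lt.2 h').ne'
  · exact h'
  · exact absurd h (expNeg_lt.2 h').ne

theorem exists_expNeg_eq {a : ℝ} (ha : 0 ≤ a) : ∃ x, expNeg x = a := by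
  rcases ha.eq_or_lt with rfl | ha
  · exact ⟨⊤, rfl⟩
  · exact ⟨((-Real.log a : ℝ) : WithTop ℝ), by rw [expNeg_coe, neg_neg, Real.exp_log ha]⟩

/-! ### The quotient weight seminorm -/

variable (I : Ideal (FormalToricRing K Γ)) (w : Γ →+ WithTop ℝ)

/-- The bounds for the value of the quotient weight seminorm, localized at the monomials of finite
weight, at an element `f` of `K[[Γ]]/I`. -/
def weightBounds (f : FormalToricRing K Γ ⧸ I) : Set ℝ :=
  {c | 0 ≤ c ∧ ∃ (F : FormalToricRing K Γ) (m : Γ), w m ≠ ⊤ ∧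
    Ideal.Quotient.mk I F = Ideal.Quotient.mk I (monomial m) * f ∧
    ∀ m', F m' ≠ 0 → expNeg (w m') ≤ c * expNeg (w m)}

variable {I w}

/-- The denominator `χ^0` suffices for a nonnegative weight. This bound is what finally makes the
valuation nonnegative. -/
theorem one_mem_weightBounds (hw : ∀ m, 0 ≤ w m) (f : FormalToricRing K Γ ⧸ I) :
    (1 : ℝ) ∈ weightBounds I w f := by
  obtain ⟨F, rfl⟩ := Ideal.Quotient.mk_surjective f
  refine ⟨zero_le_one, F, 0, by rw [map_zero]; exact WithTop.zero_ne_top, ?_, fun m' _ => ?_⟩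
  · rw [← one_eq, map_one, one_mul]
  · rw [map_zero, expNeg_zero, mul_one]
    exact expNeg_le_one (hw m')

theorem add_mem_weightBounds {f g : FormalToricRing K Γ ⧸ I} {a b : ℝ}
    (ha : a ∈ weightBounds I w f) (hb : b ∈ weightBounds I w g) :
    max a b ∈ weightBounds I w (f + g) := by
  obtain ⟨ha0, F, m, hm, hF, hFm⟩ := ha
  obtain ⟨hb0, G, k, hk, hG, hGk⟩ := hb
  refine ⟨ha0.trans (le_max_left _ _), monomial k * F + monomial m * G, m + k, ?_, ?_, ?_⟩
  · rw [map_add]; exact WithTop.add_ne_top.2 ⟨hm, hk⟩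
  · rw [map_add, map_mul, map_mul, hF, hG, monomial_add, map_mul]
    ring
  · intro m' hm'
    rw [map_add, expNeg_add]
    have hm0 := expNeg_nonneg (w m)
    have hk0 := expNeg_nonneg (w k)
    rw [FormalToricRing.add_apply] at hm'
    by_cases h : (monomial k * F : FormalToricRing K Γ) m' = 0
    · rw [h, zero_add] at hm'
      obtain ⟨c, rfl, hc⟩ := exists_of_monomial_mul_apply_ne_zero hm'
      rw [map_add, expNeg_add]
      calc expNeg (w m) * expNeg (w c) ≤ expNeg (w m) * (b * expNeg (w k)) :=
            mul_le_mul_of_nonneg_left (hGk c hc) hm0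
        _ = b * (expNeg (w m) * expNeg (w k)) := by ring
        _ ≤ _ := mul_le_mul_of_nonneg_right (le_max_right _ _) (mul_nonneg hm0 hk0)
    · obtain ⟨c, rfl, hc⟩ := exists_of_monomial_mul_apply_ne_zero h
      rw [map_add, expNeg_add]
      calc expNeg (w k) * expNeg (w c) ≤ expNeg (w k) * (a * expNeg (w m)) :=
            mul_le_mul_of_nonneg_left (hFm c hc) hk0
        _ = a * (expNeg (w m) * expNeg (w k)) := by ring
        _ ≤ _ := mul_le_mul_of_nonneg_right (le_max_left _ _) (mul_nonneg hm0 hk0)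

theorem mul_mem_weightBounds {f g : FormalToricRing K Γ ⧸ I} {a b : ℝ}
    (ha : a ∈ weightBounds I w f) (hb : b ∈ weightBounds I w g) :
    a * b ∈ weightBounds I w (f * g) := by
  obtain ⟨ha0, F, m, hm, hF, hFm⟩ := ha
  obtain ⟨hb0, G, k, hk, hG, hGk⟩ := hb
  refine ⟨mul_nonneg ha0 hb0, F * G, m + k, ?_, ?_, ?_⟩
  · rw [map_add]; exact WithTop.add_ne_top.2 ⟨hm, hk⟩
  · rw [map_mul, hF, hG, monomial_add, map_mul]
    ring
  · intro m' hm'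
    obtain ⟨c, d, rfl, hc, hd⟩ := exists_of_mul_apply_ne_zero hm'
    rw [map_add, map_add, expNeg_add, expNeg_add]
    calc _ ≤ (a * expNeg (w m)) * (b * expNeg (w k)) :=
          mul_le_mul (hFm c hc) (hGk d hd) (expNeg_nonneg _)
            (mul_nonneg ha0 (expNeg_nonneg _))
      _ = _ := by ring

theorem neg_mem_weightBounds {f : FormalToricRing K Γ ⧸ I} {a : ℝ}
    (ha : a ∈ weightBounds I w f) : a ∈ weightBounds I w (-f) := by
  obtain ⟨ha0, F, m, hm, hF, hFm⟩ := ha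
  refine ⟨ha0, -F, m, hm, by rw [map_neg, hF, mul_neg], fun m' hm' => hFm m' fun h => hm' ?_⟩
  change -F m' = 0
  rw [h, neg_zero]

theorem zero_mem_weightBounds : (0 : ℝ) ∈ weightBounds I w 0 :=
  ⟨le_rfl, 0, 0, by rw [map_zero]; exact WithTop.zero_ne_top, by simp, fun m' hm' =>
    absurd (FormalToricRing.zero_apply m') hm'⟩

theorem monomial_mem_weightBounds (m : Γ) :
    expNeg (w m) ∈ weightBounds I w (Ideal.Quotient.mk I (monomial m)) := by
  classical
  refine ⟨expNeg_nonneg _, monomial m, 0, by rw [map_zero]; exact WithTop.zero_ne_top, ?_,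
    fun m' hm' => ?_⟩
  · rw [← one_eq, map_one, one_mul]
  · rw [monomial_apply] at hm'
    have : m' = m := by by_contra h; exact hm' (if_neg h)
    rw [this, map_zero, expNeg_zero, mul_one]

/-- A denominator `χ^k` for `χ^m f` is a denominator `χ^(k + m)` for `f`. Allowing denominators thus
makes monomials multiplicative for the seminorm. -/
theorem div_mem_weightBounds {f : FormalToricRing K Γ ⧸ I} {a : ℝ} {m : Γ} (hm : w m ≠ ⊤)
    (ha : a ∈ weightBounds I w (Ideal.Quotient.mk I (monomial m) * f)) :
    a / expNeg (w m) ∈ weightBounds I w f := by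
  obtain ⟨ha0, F, k, hk, hF, hFk⟩ := ha
  refine ⟨div_nonneg ha0 (expNeg_nonneg _), F, k + m, ?_, ?_, ?_⟩
  · rw [map_add]; exact WithTop.add_ne_top.2 ⟨hk, hm⟩
  · rw [hF, monomial_add, map_mul, mul_assoc]
  · intro m' hm'
    refine (hFk m' hm').trans_eq ?_
    have := (expNeg_pos.2 hm).ne'
    rw [map_add, expNeg_add]
    field_simp

/-- A bound below 1 gives a series `F ≡ χ^m` modulo `I` all of whose terms are heavier than `χ^m`;
then `χ^m - F ∈ I` has a monomial initial form. -/
theorem one_le_of_mem_weightBounds (h : ¬ HasMonomialInitialForm I w) {a : ℝ}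
    (ha : a ∈ weightBounds I w 1) : 1 ≤ a := by
  classical
  obtain ⟨_, F, m, hm, hF, hFm⟩ := ha
  by_contra! ha
  have hpos := expNeg_pos.2 hm
  have hlt : ∀ m', F m' ≠ 0 → w m < w m' := fun m' hm' => by
    rw [← expNeg_lt]
    exact (hFm m' hm').trans_lt (mul_lt_of_lt_one_left hpos ha)
  have hF0 : F m = 0 := by
    by_contra h0
    exact lt_irrefl _ (hlt m h0)
  refine h ⟨monomial m - F, ?_, m, hm, ?_, fun m' hne hm' => hlt m' fun h0 => hm' ?_⟩
  · rw [← Ideal.Quotient.eq_zero_iff_mem, map_sub, hF, mul_one, sub_self]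
  · rw [FormalToricRing.sub_apply, monomial_apply, if_pos rfl, hF0, sub_zero]
  · rw [FormalToricRing.sub_apply, monomial_apply, if_neg hne, h0, sub_zero]

theorem sInf_weightBounds_le {f : FormalToricRing K Γ ⧸ I} {a : ℝ}
    (ha : a ∈ weightBounds I w f) : sInf (weightBounds I w f) ≤ a :=
  csInf_le ⟨0, fun _ hb => hb.1⟩ ha

/-- The quotient weight seminorm, localized at the monomials of finite weight. -/
def weightSeminorm (hw : ∀ m, 0 ≤ w m) : RingSeminorm (FormalToricRing K Γ ⧸ I) where
  toFun f := sInf (weightBounds I w f)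
  map_zero' := le_antisymm (sInf_weightBounds_le zero_mem_weightBounds)
    (Real.sInf_nonneg fun _ hb => hb.1)
  add_le' f g := by
    refine le_add_of_forall_lt fun a ha b hb => ?_
    obtain ⟨a', ha', haa⟩ := exists_lt_of_csInf_lt ⟨1, one_mem_weightBounds hw f⟩ ha
    obtain ⟨b', hb', hbb⟩ := exists_lt_of_csInf_lt ⟨1, one_mem_weightBounds hw g⟩ hb
    refine (sInf_weightBounds_le (add_mem_weightBounds ha' hb')).trans ?_
    exact (max_le_add_of_nonneg ha'.1 hb'.1).trans (add_le_add haa.le hbb.le)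
  neg' f := le_antisymm
    (le_csInf ⟨1, one_mem_weightBounds hw f⟩ fun _ ha =>
      sInf_weightBounds_le (neg_mem_weightBounds ha))
    (le_csInf ⟨1, one_mem_weightBounds hw (-f)⟩ fun _ ha =>
      sInf_weightBounds_le (neg_neg f ▸ neg_mem_weightBounds ha))
  mul_le' f g := by
    refine le_mul_of_forall_lt₀ fun a ha b hb => ?_
    obtain ⟨a', ha', haa⟩ := exists_lt_of_csInf_lt ⟨1, one_mem_weightBounds hw f⟩ ha
    obtain ⟨b', hb', hbb⟩ := exists_lt_of_csInf_lt ⟨1, one_mem_weightBounds hw g⟩ hb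
    exact (sInf_weightBounds_le (mul_mem_weightBounds ha' hb')).trans
      (mul_le_mul haa.le hbb.le hb'.1 (ha'.1.trans haa.le))

theorem weightSeminorm_isNonarchimedean (hw : ∀ m, 0 ≤ w m) :
    IsNonarchimedean (weightSeminorm (I := I) hw) := by
  intro f g
  refine le_of_forall_gt fun a ha => ?_
  obtain ⟨h1, h2⟩ := max_lt_iff.1 ha
  obtain ⟨a', ha', haa⟩ := exists_lt_of_csInf_lt ⟨1, one_mem_weightBounds hw f⟩ h1
  obtain ⟨b', hb', hbb⟩ := exists_lt_of_csInf_lt ⟨1, one_mem_weightBounds hw g⟩ h2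
  exact (sInf_weightBounds_le (add_mem_weightBounds ha' hb')).trans_lt (max_lt haa hbb)

theorem weightSeminorm_one (hw : ∀ m, 0 ≤ w m) (h : ¬ HasMonomialInitialForm I w) :
    weightSeminorm (I := I) hw 1 = 1 :=
  le_antisymm (sInf_weightBounds_le (one_mem_weightBounds hw 1))
    (le_csInf ⟨1, one_mem_weightBounds hw 1⟩ fun _ ha => one_le_of_mem_weightBounds h ha)

theorem weightSeminorm_monomial_mul (hw : ∀ m, 0 ≤ w m) (m : Γ)
    (f : FormalToricRing K Γ ⧸ I) :
    weightSeminorm hw (Ideal.Quotient.mk I (monomial m) * f) =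
      expNeg (w m) * weightSeminorm hw f := by
  refine le_antisymm ((map_mul_le_mul _ _ _).trans (mul_le_mul_of_nonneg_right
    (sInf_weightBounds_le (monomial_mem_weightBounds m)) (apply_nonneg _ _))) ?_
  by_cases hm : w m = ⊤
  · rw [hm, expNeg_top, zero_mul]
    exact apply_nonneg _ _
  · refine le_csInf ⟨1, one_mem_weightBounds hw _⟩ fun a ha => ?_
    rw [mul_comm, ← le_div_iff₀ (expNeg_pos.2 hm)]
    exact sInf_weightBounds_le (div_mem_weightBounds hm ha)

/-- If the initial ideal of `I` with respect to a nonnegative weight `w` contains no monomial, then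
`w` comes from a nonnegative real valuation of `K[[Γ]]/I`. -/
theorem exists_valuation_of_not_hasMonomialInitialForm (hw : ∀ m, 0 ≤ w m)
    (h : ¬ HasMonomialInitialForm I w) :
    ∃ v ∈ nonnegValuations (FormalToricRing K Γ ⧸ I), valComp (toQuotient I) v = w := by
  have h1 := weightSeminorm_one hw h
  obtain ⟨q, hq0, hzero, hone, hadd, hmul, hle, hX⟩ := exists_multiplicative_seminorm_le
    (weightSeminorm hw) h1 (weightSeminorm_isNonarchimedean hw)
  -- `ν` is `-log q`, infinite where `q` vanishes.
  choose ν hν using fun f => exists_expNeg_eq (hq0 f)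
  have hanti : ∀ x y, expNeg x ≤ expNeg y → y ≤ x := fun x y hxy => by
    rwa [← not_lt, expNeg_lt, not_lt] at hxy
  have hmono : ∀ x y, x ≤ y → expNeg y ≤ expNeg x := fun x y hxy => by
    rwa [← not_lt, expNeg_lt, not_lt]
  refine ⟨AddValuation.of ν (expNeg_injective (by rw [hν, hzero, expNeg_top]))
    (expNeg_injective (by rw [hν, hone, expNeg_zero])) (fun x y => ?_)
    (fun x y => expNeg_injective (by rw [expNeg_add, hν, hν, hν, hmul])), fun f => ?_, ?_⟩
  · apply hanti
    rw [hν]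
    refine (hadd x y).trans (max_le ?_ ?_)
    · rw [← hν]; exact hmono _ _ (min_le_left _ _)
    · rw [← hν]; exact hmono _ _ (min_le_right _ _)
  · apply hanti
    rw [AddValuation.of_apply, hν, expNeg_zero]
    exact (hle f).trans (sInf_weightBounds_le (one_mem_weightBounds hw f))
  · ext1 m
    apply expNeg_injective
    have hm : weightSeminorm hw (Ideal.Quotient.mk I (monomial m)) = expNeg (w m) := by
      have := weightSeminorm_monomial_mul (I := I) hw m 1
      rwa [h1, mul_one, mul_one] at this
    change expNeg (ν (Ideal.Quotient.mk I (monomial m))) = _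
    rw [hν, hX _ fun y => by rw [weightSeminorm_monomial_mul, hm], hm]

end Existence

/-! ### Division of series -/

section Division

open FormalToricRing

variable {K Γ : Type*} [Field K] [AddCancelCommMonoid Γ] [AddMonoid.FG Γ]
  [Subsingleton (AddUnits Γ)]

/-- Division of `f` by finitely many series `g a`, whose terms with exponents in a face `Φ` have the
smallest exponent `a`. The quotients are governed by the function `u`. -/
theorem exists_division {Φ : Set Γ} (hΦ : ∀ a b, a + b ∈ Φ ↔ a ∈ Φ ∧ b ∈ Φ)
    {lt : Γ → Γ → Prop} (hwf : WellFounded lt) (htrans : ∀ a b c, lt a b → lt b c → lt a c)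
    (A : Finset Γ) (g : Γ → FormalToricRing K Γ) (hlead : ∀ a ∈ A, g a a ≠ 0)
    (htail : ∀ a ∈ A, ∀ s ∈ Φ, g a s ≠ 0 → s ≠ a → ∀ q ∈ Φ, lt (q + a) (q + s))
    (f : FormalToricRing K Γ) :
    ∃ (h : Γ → FormalToricRing K Γ) (u : Γ → K),
      (∀ a q, h a q ≠ 0 → q ∈ Φ ∧ u (q + a) ≠ 0) ∧
      (∀ m, u m ≠ 0 → ∃ m' ∈ Φ, f m' ≠ 0 ∧ (m' = m ∨ lt m' m)) ∧
      ∀ m ∈ Φ, (∃ a ∈ A, ∃ c, m = a + c) → f m = (∑ a ∈ A, h a * g a) m := by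
  classical
  have hα : ∀ m, ∃ b, (∃ a ∈ A, ∃ c, m = a + c) → b ∈ A ∧ ∃ c, m = b + c := fun m => by
    by_cases hm : ∃ a ∈ A, ∃ c, m = a + c
    · obtain ⟨a, ha, hc⟩ := hm
      exact ⟨a, fun _ => ⟨ha, hc⟩⟩
    · exact ⟨0, fun h => absurd h hm⟩
  choose α hα using hα
  -- `u m` is what remains of `f m` after subtracting the contributions of quotient terms with
  -- earlier leading products. The comparison in the test makes the recursive call legal; by `htail`
  -- it discards no nonzero tail term.
  let step : ∀ m, (∀ m', lt m' m → K) → K := fun m U =>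
    if m ∈ Φ then f m - ∑ a ∈ A, ∑ p ∈ pairs m,
      (if H : lt (p.1 + a) m ∧ p.2 ≠ a ∧ α (p.1 + a) = a then
        U (p.1 + a) H.1 / g a a * g a p.2 else 0) else 0
  let u : Γ → K := hwf.fix step
  have hu : ∀ m ∈ Φ, u m = f m - ∑ a ∈ A, ∑ p ∈ pairs m,
      (if lt (p.1 + a) m ∧ p.2 ≠ a ∧ α (p.1 + a) = a then
        u (p.1 + a) / g a a * g a p.2 else 0) := fun m hm => by
    change hwf.fix step m = _
    rw [hwf.fix_eq]
    simp only [step, if_pos hm, dite_eq_ite]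
    rfl
  have hu0 : ∀ m, m ∉ Φ → u m = 0 := fun m hm => by
    change hwf.fix step m = _
    rw [hwf.fix_eq]
    simp only [step, if_neg hm]
  let h : Γ → FormalToricRing K Γ := fun a q =>
    if q ∈ Φ ∧ α (q + a) = a then u (q + a) / g a a else 0
  refine ⟨h, u, fun a q hq => ?_, fun m => ?_, fun m hm hmA => ?_⟩
  · have hq' : q ∈ Φ ∧ α (q + a) = a := by
      by_contra h0
      exact hq (if_neg h0)
    refine ⟨hq'.1, fun h0 => hq ?_⟩
    simp only [h, h0, zero_div, ite_self]
  · induction m using hwf.induction with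
    | _ m ih =>
    intro hm
    have hmΦ : m ∈ Φ := by
      by_contra h0
      exact hm (hu0 m h0)
    by_cases hf : f m = 0
    · rw [hu m hmΦ, hf, zero_sub, neg_ne_zero] at hm
      obtain ⟨a, _, hne⟩ := Finset.exists_ne_zero_of_sum_ne_zero hm
      obtain ⟨p, _, hne⟩ := Finset.exists_ne_zero_of_sum_ne_zero hne
      obtain ⟨H, hne⟩ := ite_ne_right_iff.1 hne
      have hu' : u (p.1 + a) ≠ 0 := fun h0 => hne (by rw [h0, zero_div, zero_mul])
      obtain ⟨m', hm', hfm', hlt⟩ := ih _ H.1 hu'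
      refine ⟨m', hm', hfm', Or.inr ?_⟩
      rcases hlt with rfl | hlt
      · exact H.1
      · exact htrans _ _ _ hlt H.1
    · exact ⟨m, hmΦ, hf, Or.inl rfl⟩
  · obtain ⟨hαA, c, hc⟩ := hα m hmA
    -- The leading coefficient of the divisor assigned to `m` restores `u m`; all other
    -- contributions are those subtracted in the recursion.
    have hterm : ∀ a ∈ A, ∀ p ∈ pairs m, h a p.1 * g a p.2 =
        (if p.2 = a ∧ α m = a then u m else 0) +
        (if lt (p.1 + a) m ∧ p.2 ≠ a ∧ α (p.1 + a) = a then
          u (p.1 + a) / g a a * g a p.2 else 0) := by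
      rintro a ha ⟨q, s⟩ hp
      rw [mem_pairs] at hp
      obtain rfl : q + s = m := hp
      obtain ⟨hqΦ, hsΦ⟩ := (hΦ q s).1 hm
      by_cases hs : s = a
      · subst hs
        by_cases hαs : α (q + s) = s
        · simp [h, hqΦ, hαs, hlead s ha]
        · simp [h, hαs]
      · by_cases hg : g a s = 0
        · simp [hs, hg]
        · simp [h, hs, hqΦ, htail a ha s hsΦ hg hs q hqΦ]
    have hsum : ∑ a ∈ A, ∑ p ∈ pairs m, (if p.2 = a ∧ α m = a then u m else 0) = u m := by
      rw [Finset.sum_eq_single (α m), Finset.sum_eq_single (c, α m)]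
      · simp
      · rintro ⟨q, s⟩ hp hne
        rw [mem_pairs] at hp
        refine if_neg fun H => hne ?_
        obtain rfl : s = α m := H.1
        rw [add_comm (α m) c] at hc
        exact Prod.ext (add_right_cancel (hp.trans hc)) rfl
      · intro hp
        exact absurd (mem_pairs.2 (by rw [add_comm]; exact hc.symm)) hp
      · intro a _ hne
        exact Finset.sum_eq_zero fun p _ => if_neg fun H => hne H.2.symm
      · exact fun h0 => absurd hαA h0
    rw [FormalToricRing.sum_apply]
    simp only [mul_apply]
    rw [Finset.sum_congr rfl fun a ha => Finset.sum_congr rfl (hterm a ha)]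
    simp only [Finset.sum_add_distrib]
    rw [hsum, hu m hm]
    ring

/-- A series with nonzero constant term is invertible. -/
theorem FormalToricRing.isUnit_of_apply_zero_ne_zero [IsAddTorsionFree Γ]
    {F : FormalToricRing K Γ} (hF : F 0 ≠ 0) : IsUnit F := by
  obtain ⟨r, hr⟩ := exists_isMonomialOrder Γ
  -- Dividing 1 by `F` leaves no remainder, as every exponent is a multiple of the leading exponent
  -- 0.
  obtain ⟨h, u, -, -, hdiv⟩ := exists_division (Φ := Set.univ) (by simp)
    (wellFounded_of_not_add_lt r hr.trans hr.not_add_lt) hr.trans {0} (fun _ => F)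
    (by simpa using hF) (fun a ha s _ _ hs q _ => by
      rw [Finset.mem_singleton] at ha
      subst ha
      rcases hr.trichotomous 0 s hs.symm with h | h
      · simpa only [add_comm] using hr.add_right _ _ q h
      · exact absurd h fun h => hr.not_add_lt 0 s (by rwa [zero_add])) 1
  refine IsUnit.of_mul_eq_one_right (h 0) ?_
  funext m
  rw [hdiv m trivial ⟨0, by simp, m, by simp⟩]
  simp

end Division

/-! ### Finiteness: the weights without monomial initial forms form a rational PL cone -/

section Finiteness

open FormalToricRing Filter

variable {K Γ : Type*} [Field K] [AddCancelCommMonoid Γ] [AddMonoid.FG Γ]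
variable {V : Type*} [AddCommGroup V] [Module ℝ V]

/-- A family of weights on a face `Φ` of `Γ`, depending linearly on a parameter `x ∈ V`. -/
structure IsWeightFamily (Φ : Set Γ) (ev : Γ → V →ₗ[ℝ] ℝ) : Prop where
  face : ∀ a b, a + b ∈ Φ ↔ a ∈ Φ ∧ b ∈ Φ
  add : ∀ a ∈ Φ, ∀ b ∈ Φ, ev (a + b) = ev a + ev b

/-- The parameters for which the weight is nonnegative on `Φ`. -/
def nonnegWeights (Φ : Set Γ) (ev : Γ → V →ₗ[ℝ] ℝ) : Set V := {x | ∀ m ∈ Φ, 0 ≤ ev m x}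

/-- The polyhedron of all `x` with `0 ≤ φ x` for `φ ∈ P` and `0 < φ x` for `φ ∈ Q`. -/
def halfOpenCone (P Q : Finset (V →ₗ[ℝ] ℝ)) : Set V :=
  {x | (∀ φ ∈ P, 0 ≤ φ x) ∧ ∀ φ ∈ Q, 0 < φ x}

variable {Φ : Set Γ} {ev : Γ → V →ₗ[ℝ] ℝ}

/-- Dickson's lemma gives finite generators of `G` within `G`, and adding an element of `Φ` does not
lower a nonnegative weight. -/
theorem exists_finset_forall_lt (h : IsWeightFamily Φ ev) {G : Set Γ} (hG : G ⊆ Φ) (m : Γ) :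
    ∃ B : Finset Γ, ↑B ⊆ G ∧ ∀ x ∈ nonnegWeights Φ ev, (∀ s ∈ B, ev m x < ev s x) →
      ∀ s ∈ G, ev m x < ev s x := by
  obtain ⟨B, hBG, hB⟩ := exists_finset_generating G
  refine ⟨B, hBG, fun x hx hlt s hs => ?_⟩
  obtain ⟨b, hb, c, rfl⟩ := hB s hs
  obtain ⟨hbΦ, hcΦ⟩ := (h.face b c).1 (hG hs)
  rw [h.add b hbΦ c hcΦ, LinearMap.add_apply]
  linarith [hlt b hb, hx c hcΦ]

theorem eventually_forall_lt (h : IsWeightFamily Φ ev) {l : Filter V}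
    (hl : nonnegWeights Φ ev ∈ l) {G : Set Γ} (hG : G ⊆ Φ) (m : Γ)
    (hlt : ∀ s ∈ G, ∀ᶠ x in l, ev m x < ev s x) : ∀ᶠ x in l, ∀ s ∈ G, ev m x < ev s x := by
  obtain ⟨B, hBG, hB⟩ := exists_finset_forall_lt h hG m
  filter_upwards [hl, (Finset.eventually_all B).2 fun s hs => hlt s (hBG hs)] with x hx hx'
  exact hB x hx hx'

/-- The generators of `Γ` lying in `Φ` suffice, since a sum in a face has its summands in the face.
-/
theorem exists_finset_forall_nonneg (h : IsWeightFamily Φ ev) :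
    ∃ B : Finset Γ, ↑B ⊆ Φ ∧ ∀ x, (∀ s ∈ B, 0 ≤ ev s x) → x ∈ nonnegWeights Φ ev := by
  classical
  obtain ⟨S, hS⟩ := (inferInstance : AddMonoid.FG Γ).fg_top
  refine ⟨S.filter (· ∈ Φ), fun s hs => (Finset.mem_filter.1 hs).2, fun x hx m => ?_⟩
  have hm : m ∈ AddSubmonoid.closure (S : Set Γ) := by rw [hS]; trivial
  induction hm using AddSubmonoid.closure_induction with
  | mem s hs => exact fun hsΦ => hx s (Finset.mem_filter.2 ⟨hs, hsΦ⟩)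
  | zero =>
    intro h0
    have := h.add 0 h0 0 h0
    rw [add_zero, left_eq_add] at this
    rw [this, LinearMap.zero_apply]
  | add a b _ _ iha ihb =>
    intro hab
    obtain ⟨ha, hb⟩ := (h.face a b).1 hab
    rw [h.add a ha b hb, LinearMap.add_apply]
    exact add_nonneg (iha ha) (ihb hb)

theorem exists_finset_forall_eq_zero [Module.Finite ℝ V] (E : Set (V →ₗ[ℝ] ℝ)) :
    ∃ B : Finset (V →ₗ[ℝ] ℝ), ↑B ⊆ E ∧ ∀ x, (∀ φ ∈ B, φ x = 0) → ∀ φ ∈ E, φ x = 0 := by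
  obtain ⟨B, hBE, hB⟩ := (Submodule.fg_span_iff_fg_span_finset_subset E).1
    (IsNoetherian.noetherian (Submodule.span ℝ E))
  refine ⟨B, hBE, fun x hx φ hφ => ?_⟩
  have hmem : φ ∈ Submodule.span ℝ (B : Set (V →ₗ[ℝ] ℝ)) := hB ▸ Submodule.subset_span hφ
  clear hφ
  induction hmem using Submodule.span_induction with
  | mem φ h => exact hx φ h
  | zero => rfl
  | add φ ψ _ _ h1 h2 => rw [LinearMap.add_apply, h1, h2, add_zero]
  | smul c φ _ h1 => rw [LinearMap.smul_apply, h1, smul_zero]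

/-! ### Monomial free weights, weight orders and standard bases -/

variable [Subsingleton (AddUnits Γ)]

/-- For the weight with parameter `x` on `Φ`, infinite outside `Φ`, the initial ideal of `I`
contains a monomial. -/
def HasMonomialInitialFormAt (I : Ideal (FormalToricRing K Γ)) (Φ : Set Γ)
    (ev : Γ → V →ₗ[ℝ] ℝ) (x : V) : Prop :=
  ∃ f ∈ I, ∃ m ∈ Φ, f m = 1 ∧ ∀ m' ∈ Φ, m' ≠ m → f m' ≠ 0 → ev m x < ev m' x

/-- The parameters of the nonnegative weights for which the initial ideal of `I` contains no
monomial. -/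
def monomialFreeWeights (I : Ideal (FormalToricRing K Γ)) (Φ : Set Γ) (ev : Γ → V →ₗ[ℝ] ℝ) :
    Set V :=
  {x | x ∈ nonnegWeights Φ ev ∧ ¬ HasMonomialInitialFormAt I Φ ev x}

/-- The order on `Φ` by weight, with ties broken by `r`. -/
def WeightLT (Φ : Set Γ) (ev : Γ → V →ₗ[ℝ] ℝ) (r : Γ → Γ → Prop) (x : V) (a b : Γ) : Prop :=
  a ∈ Φ ∧ b ∈ Φ ∧ (ev a x < ev b x ∨ ev a x = ev b x ∧ r a b)

section WeightLT

variable {r : Γ → Γ → Prop} {x : V} {a b c : Γ}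

theorem WeightLT.trans (hr : IsMonomialOrder r) (hab : WeightLT Φ ev r x a b)
    (hbc : WeightLT Φ ev r x b c) : WeightLT Φ ev r x a c := by
  obtain ⟨ha, -, h⟩ := hab
  obtain ⟨-, hc, h'⟩ := hbc
  refine ⟨ha, hc, ?_⟩
  rcases h with h | ⟨h, hr1⟩ <;> rcases h' with h' | ⟨h', hr2⟩
  · exact Or.inl (h.trans h')
  · exact Or.inl (h.trans_eq h')
  · exact Or.inl (h.trans_lt h')
  · exact Or.inr ⟨h.trans h', hr.trans _ _ _ hr1 hr2⟩

theorem WeightLT.not_add_lt (hr : IsMonomialOrder r) (h : IsWeightFamily Φ ev)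
    (hx : x ∈ nonnegWeights Φ ev) : ¬ WeightLT Φ ev r x (a + c) a := by
  rintro ⟨hac, ha, hlt⟩
  have hc := ((h.face a c).1 hac).2
  rw [h.add a ha c hc, LinearMap.add_apply] at hlt
  rcases hlt with hlt | ⟨-, hlt⟩
  · linarith [hx c hc]
  · exact hr.not_add_lt a c hlt

theorem WeightLT.trichotomous (hr : IsMonomialOrder r) (ha : a ∈ Φ) (hb : b ∈ Φ) (hab : a ≠ b) :
    WeightLT Φ ev r x a b ∨ WeightLT Φ ev r x b a := by
  rcases lt_trichotomy (ev a x) (ev b x) with h | h | h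
  · exact Or.inl ⟨ha, hb, Or.inl h⟩
  · rcases hr.trichotomous a b hab with h' | h'
    · exact Or.inl ⟨ha, hb, Or.inr ⟨h, h'⟩⟩
    · exact Or.inr ⟨hb, ha, Or.inr ⟨h.symm, h'⟩⟩
  · exact Or.inr ⟨hb, ha, Or.inl h⟩

theorem WeightLT.wellFounded (hr : IsMonomialOrder r) (h : IsWeightFamily Φ ev)
    (hx : x ∈ nonnegWeights Φ ev) : WellFounded (WeightLT Φ ev r x) :=
  wellFounded_of_not_add_lt _ (fun _ _ _ => WeightLT.trans hr) fun _ _ =>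
    WeightLT.not_add_lt hr h hx

end WeightLT

/-- A standard basis of `I` with respect to the order on `Φ` by the generic weight of an
ultrafilter. -/
theorem exists_standard_basis (h : IsWeightFamily Φ ev) {r : Γ → Γ → Prop}
    (hr : IsMonomialOrder r) (𝒰 : Ultrafilter V) (h𝒰 : nonnegWeights Φ ev ∈ 𝒰)
    (I : Ideal (FormalToricRing K Γ)) :
    ∃ (A : Finset Γ) (g : Γ → FormalToricRing K Γ),
      (∀ a ∈ A, a ∈ Φ ∧ g a ∈ I ∧ g a a ≠ 0 ∧
        ∀ s ∈ Φ, g a s ≠ 0 → s ≠ a → ∀ᶠ x in 𝒰, WeightLT Φ ev r x a s) ∧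
      ∀ f ∈ I, ∀ m ∈ Φ, f m ≠ 0 → ∃ m' ∈ Φ, f m' ≠ 0 ∧ ∃ a ∈ A, ∃ c, m' = a + c := by
  let lt : Γ → Γ → Prop := fun a b => ∀ᶠ x in 𝒰, WeightLT Φ ev r x a b
  have hwf : WellFounded lt := by
    refine wellFounded_of_not_add_lt lt (fun a b c hab hbc => ?_) fun a c hac => ?_
    · filter_upwards [hab, hbc] with x h1 h2 using h1.trans hr h2
    · obtain ⟨x, hx, hx'⟩ := (hac.and h𝒰).exists
      exact WeightLT.not_add_lt hr h hx' hx
  -- The leading exponents of elements of `I` for the generic order; `A` is a finite generating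
  -- subset.
  let L : Set Γ := {a | a ∈ Φ ∧ ∃ g ∈ I, g a ≠ 0 ∧ ∀ s ∈ Φ, g s ≠ 0 → s ≠ a → lt a s}
  obtain ⟨A, hAL, hA⟩ := exists_finset_generating L
  have : ∀ a, ∃ g : FormalToricRing K Γ, a ∈ A →
      g ∈ I ∧ g a ≠ 0 ∧ ∀ s ∈ Φ, g s ≠ 0 → s ≠ a → lt a s := fun a => by
    by_cases ha : a ∈ A
    · obtain ⟨-, g, hg⟩ := hAL ha
      exact ⟨g, fun _ => hg⟩
    · exact ⟨0, fun h => absurd h ha⟩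
  choose g hg using this
  refine ⟨A, g, fun a ha => ⟨(hAL ha).1, hg a ha⟩, fun f hf m hm hfm => ?_⟩
  obtain ⟨m', ⟨hm', hfm'⟩, hmin⟩ := hwf.has_min {s | s ∈ Φ ∧ f s ≠ 0} ⟨m, hm, hfm⟩
  refine ⟨m', hm', hfm', hA m' ⟨hm', f, hf, hfm', fun s hs hfs hne => ?_⟩⟩
  -- An ultrafilter decides each comparison, so the generic order is total on `Φ`.
  rcases Ultrafilter.eventually_or.1 (Eventually.of_forall fun x =>
    WeightLT.trichotomous (ev := ev) (x := x) hr hm' hs hne.symm) with h1 | h1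
  · exact h1
  · exact absurd h1 (hmin s ⟨hs, hfs⟩)

end Finiteness

/-! ### Cells of constant initial forms and the compactness argument -/

section FinitenessLocal

open FormalToricRing Filter

variable {K Γ : Type*} [Field K] [AddCancelCommMonoid Γ] [AddMonoid.FG Γ]
variable {V : Type*} [AddCommGroup V] [Module ℝ V] {Φ : Set Γ} {ev : Γ → V →ₗ[ℝ] ℝ}

/-- The parameters of the nonnegative weights satisfying the equalities `ev s = ev a` for
`s ∈ E a` and the inequalities `ev a < ev s` for `s ∈ G a`, where `a ∈ A`. -/
def comparisonCell (Φ : Set Γ) (ev : Γ → V →ₗ[ℝ] ℝ) (A : Finset Γ) (E G : Γ → Set Γ) : Set V :=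
  {x | x ∈ nonnegWeights Φ ev ∧
    ∀ a ∈ A, (∀ s ∈ E a, ev s x = ev a x) ∧ ∀ s ∈ G a, ev a x < ev s x}

/-- A filter is closed only under finite intersections. Finite dimension reduces the equalities to
finitely many, Dickson's lemma the strict inequalities. -/
theorem comparisonCell_mem (h : IsWeightFamily Φ ev) [Module.Finite ℝ V] {l : Filter V}
    (hl : nonnegWeights Φ ev ∈ l) {A : Finset Γ} {E G : Γ → Set Γ} (hG : ∀ a ∈ A, G a ⊆ Φ)
    (hE : ∀ a ∈ A, ∀ s ∈ E a, ∀ᶠ x in l, ev s x = ev a x)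
    (hlt : ∀ a ∈ A, ∀ s ∈ G a, ∀ᶠ x in l, ev a x < ev s x) :
    comparisonCell Φ ev A E G ∈ l := by
  have h1 : ∀ᶠ x in l, ∀ a ∈ A, ∀ s ∈ E a, ev s x = ev a x := by
    refine (Finset.eventually_all A).2 fun a ha => ?_
    obtain ⟨B, hBE, hB⟩ := exists_finset_forall_eq_zero ((fun s => ev s - ev a) '' E a)
    have : ∀ᶠ x in l, ∀ φ ∈ B, φ x = 0 := (Finset.eventually_all B).2 fun φ hφ => by
      obtain ⟨s, hs, rfl⟩ := hBE hφ
      filter_upwards [hE a ha s hs] with x hx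
      rw [LinearMap.sub_apply, hx, sub_self]
    filter_upwards [this] with x hx s hs
    exact sub_eq_zero.1 (hB x hx _ ⟨s, hs, rfl⟩)
  have h2 : ∀ᶠ x in l, ∀ a ∈ A, ∀ s ∈ G a, ev a x < ev s x :=
    (Finset.eventually_all A).2 fun a ha => eventually_forall_lt h hl (hG a ha) a (hlt a ha)
  filter_upwards [hl, h1, h2] with x hx hx1 hx2
  exact ⟨hx, fun a ha => ⟨hx1 a ha, hx2 a ha⟩⟩

theorem comparisonCell_eq_halfOpenCone (h : IsWeightFamily Φ ev) [Module.Finite ℝ V]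
    {L : AddSubgroup (V →ₗ[ℝ] ℝ)} (hL : ∀ m ∈ Φ, ev m ∈ L) {A : Finset Γ} {E G : Γ → Set Γ}
    (hA : ∀ a ∈ A, a ∈ Φ) (hE : ∀ a ∈ A, E a ⊆ Φ) (hG : ∀ a ∈ A, G a ⊆ Φ) :
    ∃ P Q : Finset (V →ₗ[ℝ] ℝ), (∀ φ ∈ P, φ ∈ L) ∧ (∀ φ ∈ Q, φ ∈ L) ∧
      comparisonCell Φ ev A E G = halfOpenCone P Q := by
  classical
  obtain ⟨B, hBΦ, hB⟩ := exists_finset_forall_nonneg h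
  choose BE hBE hBE' using fun a => exists_finset_forall_eq_zero ((fun s => ev s - ev a) '' E a)
  have : ∀ a, ∃ B : Finset Γ, a ∈ A → (↑B ⊆ G a ∧ ∀ x ∈ nonnegWeights Φ ev,
      (∀ s ∈ B, ev a x < ev s x) → ∀ s ∈ G a, ev a x < ev s x) := fun a => by
    by_cases ha : a ∈ A
    · obtain ⟨B, hB⟩ := exists_finset_forall_lt h (hG a ha) a
      exact ⟨B, fun _ => hB⟩
    · exact ⟨∅, fun h => absurd h ha⟩
  choose BG hBG using this
  refine ⟨B.image ev ∪ A.biUnion fun a => BE a ∪ (BE a).image (fun φ => -φ),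
    A.biUnion fun a => (BG a).image fun s => ev s - ev a, ?_, ?_, ?_⟩
  · intro φ hφ
    simp only [Finset.mem_union, Finset.mem_image, Finset.mem_biUnion] at hφ
    have hmem : ∀ a ∈ A, ∀ φ ∈ BE a, φ ∈ L := fun a ha φ hφ => by
      obtain ⟨s, hs, rfl⟩ := hBE a hφ
      exact L.sub_mem (hL s (hE a ha hs)) (hL a (hA a ha))
    rcases hφ with ⟨s, hs, rfl⟩ | ⟨a, ha, hφ | ⟨ψ, hψ, rfl⟩⟩
    · exact hL s (hBΦ hs)
    · exact hmem a ha φ hφ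
    · exact L.neg_mem (hmem a ha ψ hψ)
  · intro φ hφ
    simp only [Finset.mem_image, Finset.mem_biUnion] at hφ
    obtain ⟨a, ha, s, hs, rfl⟩ := hφ
    exact L.sub_mem (hL s (hG a ha ((hBG a ha).1 hs))) (hL a (hA a ha))
  · ext x
    constructor
    · rintro ⟨hx, hx'⟩
      refine ⟨fun φ hφ => ?_, fun φ hφ => ?_⟩
      · simp only [Finset.mem_union, Finset.mem_image, Finset.mem_biUnion] at hφ
        have hz : ∀ a ∈ A, ∀ φ ∈ BE a, φ x = 0 := fun a ha φ hφ => by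
          obtain ⟨s, hs, rfl⟩ := hBE a hφ
          exact sub_eq_zero.2 ((hx' a ha).1 s hs)
        rcases hφ with ⟨s, hs, rfl⟩ | ⟨a, ha, hφ | ⟨ψ, hψ, rfl⟩⟩
        · exact hx s (hBΦ hs)
        · exact (hz a ha φ hφ).ge
        · rw [LinearMap.neg_apply, hz a ha ψ hψ, neg_zero]
      · simp only [Finset.mem_image, Finset.mem_biUnion] at hφ
        obtain ⟨a, ha, s, hs, rfl⟩ := hφ
        exact sub_pos.2 ((hx' a ha).2 s ((hBG a ha).1 hs))
    · rintro ⟨hP, hQ⟩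
      have hx : x ∈ nonnegWeights Φ ev := hB x fun s hs =>
        hP _ (Finset.mem_union_left _ (Finset.mem_image_of_mem _ hs))
      refine ⟨hx, fun a ha => ⟨fun s hs => ?_, ?_⟩⟩
      · refine sub_eq_zero.1 (hBE' a x (fun φ hφ => le_antisymm ?_ ?_) _ ⟨s, hs, rfl⟩)
        · have := hP (-φ) (Finset.mem_union_right _ (Finset.mem_biUnion.2 ⟨a, ha,
            Finset.mem_union_right _ (Finset.mem_image_of_mem _ hφ)⟩))
          rw [LinearMap.neg_apply] at this
          linarith
        · exact hP φ (Finset.mem_union_right _ (Finset.mem_biUnion.2 ⟨a, ha,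
            Finset.mem_union_left _ hφ⟩))
      · refine (hBG a ha).2 x hx fun s hs => sub_pos.1 ?_
        exact hQ (ev s - ev a) (Finset.mem_biUnion.2 ⟨a, ha, Finset.mem_image.2 ⟨s, hs, rfl⟩⟩)

variable [Subsingleton (AddUnits Γ)]

/-- An ultrafilter of parameters of monomial free weights contains a rational half-open cone of
such parameters: a cell on which the initial forms of a standard basis are constant. -/
theorem exists_halfOpenCone_subset [IsAddTorsionFree Γ] (h : IsWeightFamily Φ ev)
    [Module.Finite ℝ V] {L : AddSubgroup (V →ₗ[ℝ] ℝ)} (hL : ∀ m ∈ Φ, ev m ∈ L)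
    (I : Ideal (FormalToricRing K Γ)) (𝒰 : Ultrafilter V)
    (h𝒰 : monomialFreeWeights I Φ ev ∈ 𝒰) :
    ∃ P Q : Finset (V →ₗ[ℝ] ℝ), (∀ φ ∈ P, φ ∈ L) ∧ (∀ φ ∈ Q, φ ∈ L) ∧
      halfOpenCone P Q ∈ 𝒰 ∧ halfOpenCone P Q ⊆ monomialFreeWeights I Φ ev := by
  classical
  obtain ⟨r, hr⟩ := exists_isMonomialOrder Γ
  have hnn : nonnegWeights Φ ev ∈ 𝒰 := mem_of_superset h𝒰 fun x hx => hx.1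
  obtain ⟨A, g, hA, hstd⟩ := exists_standard_basis h hr 𝒰 hnn I
  -- The terms of `g a` on `Φ` split into the generic initial form `E a` and the generically heavier
  -- terms `G a`.
  let E : Γ → Set Γ := fun a => {s | s ∈ Φ ∧ g a s ≠ 0 ∧ ∀ᶠ x in 𝒰, ev s x = ev a x}
  let G : Γ → Set Γ := fun a => {s | s ∈ Φ ∧ g a s ≠ 0 ∧ ∀ᶠ x in 𝒰, ev a x < ev s x}
  have hEG : ∀ a ∈ A, ∀ s ∈ Φ, g a s ≠ 0 → s ∈ E a ∧ (s ≠ a → r a s) ∨ s ∈ G a := by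
    intro a ha s hs hgs
    by_cases hsa : s = a
    · exact Or.inl ⟨⟨hs, hgs, Eventually.of_forall fun x => by rw [hsa]⟩, fun h => absurd hsa h⟩
    · rcases Ultrafilter.eventually_or.1 (((hA a ha).2.2.2 s hs hgs hsa).mono fun x hx => hx.2.2)
        with h1 | h1
      · exact Or.inr ⟨hs, hgs, h1⟩
      · exact Or.inl ⟨⟨hs, hgs, h1.mono fun x hx => hx.1.symm⟩, fun _ => h1.exists.choose_spec.2⟩
  have hcell : comparisonCell Φ ev A E G ∈ 𝒰 :=
    comparisonCell_mem h hnn (fun a _ s hs => hs.1) (fun a _ s hs => hs.2.2)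
      (fun a _ s hs => hs.2.2)
  obtain ⟨P, Q, hP, hQ, hPQ⟩ := comparisonCell_eq_halfOpenCone h hL (A := A) (E := E) (G := G)
    (fun a ha => (hA a ha).1) (fun a _ s hs => hs.1) (fun a _ s hs => hs.1)
  refine ⟨P, Q, hP, hQ, hPQ ▸ hcell, hPQ ▸ fun x hx => ⟨hx.1, ?_⟩⟩
  rintro ⟨f, hf, m, hm, hfm, hlt⟩
  -- Division uses the order at `x`, not the generic one: on the cell, `a` is still the leading
  -- exponent of `g a`.
  obtain ⟨q, u, hq, hu, hdiv⟩ := exists_division h.face (WeightLT.wellFounded hr h hx.1)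
    (fun _ _ _ => WeightLT.trans hr) A g (fun a ha => (hA a ha).2.2.1)
    (fun a ha s hs hgs hsa c hc => by
      have haΦ := (hA a ha).1
      refine ⟨(h.face _ _).2 ⟨hc, haΦ⟩, (h.face _ _).2 ⟨hc, hs⟩, ?_⟩
      rw [h.add c hc a haΦ, h.add c hc s hs, LinearMap.add_apply, LinearMap.add_apply]
      rcases hEG a ha s hs hgs with ⟨h1, h2⟩ | h1
      · refine Or.inr ⟨by rw [(hx.2 a ha).1 s h1], ?_⟩
        rw [add_comm c, add_comm c]
        exact hr.add_right _ _ _ (h2 hsa)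
      · exact Or.inl (by linarith [(hx.2 a ha).2 s h1])) f
  -- The remainder vanishes on `Φ`.
  have hsumI : ∀ q : Γ → FormalToricRing K Γ, ∑ a ∈ A, q a * g a ∈ I := fun q =>
    I.sum_mem fun a ha => I.mul_mem_left _ (hA a ha).2.1
  have hrem : ∀ m ∈ Φ, f m = (∑ a ∈ A, q a * g a) m := by
    intro m' hm'
    by_contra hne
    obtain ⟨m'', hm'', hne', hA'⟩ := hstd _ (I.sub_mem hf (hsumI q)) m' hm'
      (by rw [FormalToricRing.sub_apply]; exact sub_ne_zero.2 hne)
    rw [FormalToricRing.sub_apply] at hne'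
    exact hne' (sub_eq_zero.2 (hdiv m'' hm'' hA'))
  -- Nonzero quotient terms trace back to the support of `f`, where `m` has the least weight at `x`.
  have hqx : ∀ a c, q a c ≠ 0 → c ∈ Φ ∧ ev m x ≤ ev (c + a) x := by
    intro a c hac
    obtain ⟨hc, hne⟩ := hq a c hac
    obtain ⟨m', hm', hfm', hle⟩ := hu _ hne
    refine ⟨hc, ?_⟩
    have h1 : ev m x ≤ ev m' x := by
      by_cases hmm : m' = m
      · rw [hmm]
      · exact (hlt m' hm' hmm hfm').le
    rcases hle with h2 | h2
    · rwa [h2] at h1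
    · rcases h2.2.2 with h3 | h3
      · exact h1.trans h3.le
      · exact h1.trans_eq h3.1
  -- Keep only the quotients of the weight of `m`, both at `x` and along the ultrafilter.
  let Z : Γ → Prop := fun c => ev c x = ev m x ∧ ∀ᶠ y in 𝒰, ev c y = ev m y
  let q' : Γ → FormalToricRing K Γ := fun a c => if Z (c + a) then q a c else 0
  have hq' : ∀ a c, q' a c ≠ 0 → Z (c + a) ∧ c ∈ Φ := fun a c hc => by
    have hZ : Z (c + a) := by
      by_contra h0
      exact hc (if_neg h0)
    refine ⟨hZ, (hqx a c fun h0 => hc ?_).1⟩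
    simp only [q', h0, ite_self]
  have hadd : ∀ a ∈ A, ∀ c ∈ Φ, ∀ s ∈ Φ, ∀ y,
      ev (c + s) y - ev s y = ev (c + a) y - ev a y := fun a ha c hc s hs y => by
    rw [h.add c hc s hs, h.add c hc a (hA a ha).1, LinearMap.add_apply, LinearMap.add_apply]
    ring
  -- Replacing `a` by another exponent of the initial form changes the weight neither at `x` nor
  -- generically, so the truncation respects initial forms.
  have hZE : ∀ a ∈ A, ∀ c ∈ Φ, ∀ s ∈ E a, (Z (c + s) ↔ Z (c + a)) := by
    intro a ha c hc s hs
    have h1 : ev (c + s) x = ev (c + a) x := by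
      linarith [hadd a ha c hc s hs.1 x, (hx.2 a ha).1 s hs]
    have h2 : ∀ᶠ y in 𝒰, ev (c + s) y = ev (c + a) y := by
      filter_upwards [hs.2.2] with y hy
      linarith [hadd a ha c hc s hs.1 y]
    refine and_congr (by rw [h1]) (eventually_congr ?_)
    filter_upwards [h2] with y hy
    rw [hy]
  let f' : FormalToricRing K Γ := ∑ a ∈ A, q' a * g a
  have hf'Z : ∀ m' ∈ Φ, Z m' → f' m' = f m' := by
    intro m' hm' hZ
    rw [hrem m' hm']
    simp only [f', FormalToricRing.sum_apply, mul_apply]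
    refine Finset.sum_congr rfl fun a ha => Finset.sum_congr rfl ?_
    rintro ⟨c, s⟩ hp
    rw [mem_pairs] at hp
    obtain rfl : c + s = m' := hp
    obtain ⟨hc, hs⟩ := (h.face c s).1 hm'
    by_cases hgs : g a s = 0
    · simp only [hgs, mul_zero]
    rcases hEG a ha s hs hgs with ⟨h1, -⟩ | h1
    · have : Z (c + a) := (hZE a ha c hc s h1).1 hZ
      simp only [q', if_pos this]
    · have : q a c = 0 := by
        by_contra h0
        linarith [(hqx a c h0).2, hadd a ha c hc s hs x, (hx.2 a ha).2 s h1, hZ.1]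
      simp only [q', this, ite_self]
  -- Exponents of `f'` outside `Z` come only from terms in `G a`, which are generically heavier.
  -- Hence `f'` has initial form `χ^m` generically, contradicting monomial freeness on a set of the
  -- ultrafilter.
  have hf'lt : ∀ m' ∈ Φ, m' ≠ m → f' m' ≠ 0 → ∀ᶠ y in 𝒰, ev m y < ev m' y := by
    intro m' hm' hne hfm'
    by_cases hZ : Z m'
    · rw [hf'Z m' hm' hZ] at hfm'
      exact absurd hZ.1 (hlt m' hm' hne hfm').ne'
    · simp only [f', FormalToricRing.sum_apply] at hfm'
      obtain ⟨a, ha, hne⟩ := Finset.exists_ne_zero_of_sum_ne_zero hfm'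
      obtain ⟨c, s, rfl, hc0, hgs⟩ := exists_of_mul_apply_ne_zero hne
      obtain ⟨hc, hs⟩ := (h.face c s).1 hm'
      obtain ⟨hZ', -⟩ := hq' a c hc0
      rcases hEG a ha s hs hgs with ⟨h1, -⟩ | h1
      · exact absurd ((hZE a ha c hc s h1).2 hZ') hZ
      · filter_upwards [hZ'.2, h1.2.2] with y hy hy'
        linarith [hadd a ha c hc s hs y]
  have hev := eventually_forall_lt h hnn (G := {m' | m' ∈ Φ ∧ m' ≠ m ∧ f' m' ≠ 0})
    (fun m' hm' => hm'.1) m fun m' hm' => hf'lt m' hm'.1 hm'.2.1 hm'.2.2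
  obtain ⟨y, hy, hyT⟩ := (hev.and h𝒰).exists
  refine hyT.2 ⟨f', hsumI q', m, hm, ?_, fun m' hm' hne hfm' => hy m' ⟨hm', hne, hfm'⟩⟩
  rw [hf'Z m hm ⟨rfl, Eventually.of_forall fun _ => rfl⟩, hfm]

/-- The monomial free weights form a finite union of rational closed cones. -/
theorem exists_finite_cones [IsAddTorsionFree Γ] (h : IsWeightFamily Φ ev)
    [Module.Finite ℝ V] {L : AddSubgroup (V →ₗ[ℝ] ℝ)} (hL : ∀ m ∈ Φ, ev m ∈ L)
    (I : Ideal (FormalToricRing K Γ)) :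
    ∃ 𝒞 : Set (Set V), 𝒞.Finite ∧
      (∀ C ∈ 𝒞, ∃ P : Finset (V →ₗ[ℝ] ℝ), (∀ φ ∈ P, φ ∈ L) ∧ C = {x | ∀ φ ∈ P, 0 ≤ φ x}) ∧
      monomialFreeWeights I Φ ev = ⋃₀ 𝒞 := by
  classical
  let T := monomialFreeWeights I Φ ev
  -- A monomial initial form at `x` is witnessed by finitely many strict inequalities, so it
  -- persists at `x + ε • y` for small `ε`.
  have hclosed : ∀ x y, (∀ ε : ℝ, 0 < ε → x + ε • y ∈ T) → x ∈ T := by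
    intro x y hxy
    have hx : x ∈ nonnegWeights Φ ev := fun m hm => by
      have hcont : Continuous fun ε : ℝ => ev m (x + ε • y) := by
        simp only [map_add, map_smul, smul_eq_mul]
        fun_prop
      have hlim : Tendsto (fun ε : ℝ => ev m (x + ε • y)) (nhdsWithin 0 (Set.Ioi 0))
          (nhds (ev m x)) := by
        simpa using (hcont.tendsto 0).mono_left nhdsWithin_le_nhds
      exact ge_of_tendsto hlim (eventually_mem_nhdsWithin.mono fun ε hε => (hxy ε hε).1 m hm)
    refine ⟨hx, ?_⟩
    rintro ⟨f, hf, m, hm, hfm, hlt⟩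
    obtain ⟨B, hBG, hB⟩ := exists_finset_forall_lt h
      (G := {m' | m' ∈ Φ ∧ m' ≠ m ∧ f m' ≠ 0}) (fun m' hm' => hm'.1) m
    have hev : ∀ᶠ ε : ℝ in nhdsWithin 0 (Set.Ioi 0),
        ∀ s ∈ B, ev m (x + ε • y) < ev s (x + ε • y) := by
      refine (Finset.eventually_all B).2 fun s hs => ?_
      have hcont : ∀ s, Continuous fun ε : ℝ => ev s (x + ε • y) := fun s => by
        simp only [map_add, map_smul, smul_eq_mul]
        fun_prop
      have hs' := hBG hs
      refine nhdsWithin_le_nhds ((hcont m).continuousAt.eventually_lt (hcont s).continuousAt ?_)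
      simpa using hlt s hs'.1 hs'.2.1 hs'.2.2
    obtain ⟨ε, hε, hε0⟩ := (hev.and eventually_mem_nhdsWithin).exists
    have hT := hxy ε hε0
    exact hT.2 ⟨f, hf, m, hm, hfm, fun m' hm' hne hfm' =>
      hB _ hT.1 hε m' ⟨hm', hne, hfm'⟩⟩
  -- Compactness of the space of ultrafilters.
  let ι := {c : Finset (V →ₗ[ℝ] ℝ) × Finset (V →ₗ[ℝ] ℝ) // (∀ φ ∈ c.1, φ ∈ L) ∧
    (∀ φ ∈ c.2, φ ∈ L) ∧ halfOpenCone c.1 c.2 ⊆ T}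
  obtain ⟨t, ht⟩ := (ultrafilter_isClosed_basic T).isCompact.elim_finite_subcover
    (fun c : ι => {u : Ultrafilter V | halfOpenCone c.1.1 c.1.2 ∈ u})
    (fun c => ultrafilter_isOpen_basic _) (fun u hu => by
      obtain ⟨P, Q, hP, hQ, hmem, hsub⟩ := exists_halfOpenCone_subset h hL I u hu
      exact Set.mem_iUnion.2 ⟨⟨(P, Q), hP, hQ, hsub⟩, hmem⟩)
  -- Empty cones are discarded: `hclosed` needs a point `y` of the half-open cone toward which to
  -- move.
  let t' := t.filter fun c => (halfOpenCone c.1.1 c.1.2).Nonempty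
  let cone : ι → Set V := fun c => {x | ∀ φ ∈ c.1.1 ∪ c.1.2, 0 ≤ φ x}
  refine ⟨t'.image cone, Finset.finite_toSet _, ?_, ?_⟩
  · intro C hC
    obtain ⟨c, _, rfl⟩ := Finset.mem_image.1 (Finset.mem_coe.1 hC)
    refine ⟨c.1.1 ∪ c.1.2, fun φ hφ => ?_, rfl⟩
    rcases Finset.mem_union.1 hφ with hφ | hφ
    · exact c.2.1 φ hφ
    · exact c.2.2.1 φ hφ
  · ext x
    constructor
    · intro hx
      have hx' : (pure x : Ultrafilter V) ∈ {u : Ultrafilter V | T ∈ u} := by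
        change T ∈ (pure x : Ultrafilter V)
        exact Ultrafilter.mem_pure.2 hx
      obtain ⟨c, hc, hxc⟩ := Set.mem_iUnion₂.1 (ht hx')
      have hxc' : x ∈ halfOpenCone c.1.1 c.1.2 := Ultrafilter.mem_pure.1 hxc
      refine ⟨cone c, Finset.mem_coe.2 (Finset.mem_image_of_mem _
        (Finset.mem_filter.2 ⟨hc, x, hxc'⟩)), fun φ hφ => ?_⟩
      rcases Finset.mem_union.1 hφ with hφ | hφ
      · exact hxc'.1 φ hφ
      · exact (hxc'.2 φ hφ).le
    · rintro ⟨C, hC, hxC⟩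
      obtain ⟨c, hc, rfl⟩ := Finset.mem_image.1 (Finset.mem_coe.1 hC)
      obtain ⟨y, hy⟩ := (Finset.mem_filter.1 hc).2
      refine hclosed x y fun ε hε => c.2.2.2 ⟨fun φ hφ => ?_, fun φ hφ => ?_⟩
      · rw [map_add, map_smul, smul_eq_mul]
        exact add_nonneg (hxC φ (Finset.mem_union_left _ hφ)) (mul_nonneg hε.le (hy.1 φ hφ))
      · rw [map_add, map_smul, smul_eq_mul]
        exact add_pos_of_nonneg_of_pos (hxC φ (Finset.mem_union_right _ hφ))
          (mul_pos hε (hy.2 φ hφ))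

end FinitenessLocal

/-! ### Local tropicalizations of ideals of `K[[Γ]]` -/

section LocalTropicalization

open FormalToricRing

variable {K Γ : Type*} [Field K] [AddCancelCommMonoid Γ]

theorem nonneg_of_nonneg_toSaturation {u : LinearVariety Γ}
    (hu : ∀ a, 0 ≤ u (toSaturation Γ a)) (m : saturation Γ) : 0 ≤ u m := by
  obtain ⟨m, n, hn, a, h⟩ := m
  have h1 : n • u ⟨m, n, hn, a, h⟩ = u (toSaturation Γ a) := by
    rw [← map_nsmul]
    exact congrArg u (Subtype.ext h)
  have h2 := h1 ▸ hu a
  generalize u ⟨m, n, hn, a, h⟩ = y at h2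
  induction y with
  | top => exact le_top
  | coe y =>
    rw [← WithTop.coe_nsmul, ← WithTop.coe_zero, WithTop.coe_le_coe, nsmul_eq_mul] at h2
    exact WithTop.coe_nonneg.2
      (nonneg_of_mul_nonneg_right h2 (by exact_mod_cast Nat.pos_of_ne_zero hn))

variable [AddMonoid.FG Γ] [Subsingleton (AddUnits Γ)]

theorem tropMap_eq_iff {R : Type*} [CommRing R] (γ : Multiplicative Γ →* R)
    (v : AddValuation R (WithTop ℝ)) (u : LinearVariety Γ) :
    tropMap γ v = u ↔ valComp γ v = u.comp (toSaturation Γ) := by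
  constructor
  · rintro rfl
    ext1 a
    exact (LinearVariety.ofHom_apply _ a).symm
  · intro h
    refine (existsUnique_extension (valComp γ v)).unique (LinearVariety.ofHom_apply _) fun a => ?_
    rw [h]
    rfl

theorem mem_nntrop_iff {I : Ideal (FormalToricRing K Γ)} {u : LinearVariety Γ} :
    u ∈ nntrop I ↔ (∀ a, 0 ≤ u (toSaturation Γ a)) ∧
      ¬ HasMonomialInitialForm I fun a => u (toSaturation Γ a) := by
  constructor
  · rintro ⟨v, hv, hvu⟩
    rw [tropMap_eq_iff] at hvu
    have h : ∀ a, u (toSaturation Γ a) = valComp (toQuotient I) v a := fun a =>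
      (DFunLike.congr_fun hvu a).symm
    simp only [h]
    exact ⟨fun a => hv _, not_hasMonomialInitialForm_of_valuation hv⟩
  · rintro ⟨hu, h⟩
    obtain ⟨v, hv, hvu⟩ := exists_valuation_of_not_hasMonomialInitialForm (I := I)
      (w := u.comp (toSaturation Γ)) hu h
    exact ⟨v, hv, (tropMap_eq_iff _ _ _).2 hvu⟩

theorem nntrop_subset_extendedCone (I : Ideal (FormalToricRing K Γ)) :
    nntrop I ⊆ extendedCone Γ := fun _ hu =>
  nonneg_of_nonneg_toSaturation (mem_nntrop_iff.1 hu).1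

theorem continuous_apply_linearVariety (m : saturation Γ) :
    Continuous fun u : LinearVariety Γ => u m :=
  (continuous_apply m).comp continuous_induced_dom

/-- Finiteness at `m` and finitely many strict inequalities are open conditions; for nonnegative
points Dickson's lemma extends them to the whole support. -/
theorem isClosed_nntrop (I : Ideal (FormalToricRing K Γ)) : IsClosed (nntrop I) := by
  rw [← isOpen_compl_iff, isOpen_iff_mem_nhds]
  intro u hu
  rw [Set.mem_compl_iff, mem_nntrop_iff, not_and_or, not_not] at hu
  have hcont := fun a => continuous_apply_linearVariety (toSaturation Γ a)
  by_cases hnn : ∀ a, 0 ≤ u (toSaturation Γ a)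
  · obtain ⟨f, hf, m, hm, hfm, hlt⟩ := hu.resolve_left (not_not.2 hnn)
    obtain ⟨B, hBG, hB⟩ := exists_finset_generating {m' | m' ≠ m ∧ f m' ≠ 0}
    have h1 : ∀ᶠ u' : LinearVariety Γ in nhds u, u' (toSaturation Γ m) < ⊤ :=
      (isOpen_Iio.preimage (hcont m)).mem_nhds (lt_top_iff_ne_top.2 hm)
    have h2 : ∀ᶠ u' : LinearVariety Γ in nhds u,
        ∀ b ∈ B, u' (toSaturation Γ m) < u' (toSaturation Γ b) :=
      (Filter.eventually_all_finset B).2 fun b hb =>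
        (isOpen_lt (hcont m) (hcont b)).mem_nhds (hlt b (hBG hb).1 (hBG hb).2)
    filter_upwards [h1, h2] with u' h1 h2 hmem
    rw [mem_nntrop_iff] at hmem
    refine hmem.2 ⟨f, hf, m, h1.ne, hfm, fun m' hne hm' => ?_⟩
    obtain ⟨b, hb, c, rfl⟩ := hB m' ⟨hne, hm'⟩
    simp only [map_add]
    exact (h2 b hb).trans_le (le_add_of_nonneg_right (hmem.1 c))
  · push Not at hnn
    obtain ⟨a, ha⟩ := hnn
    filter_upwards [(isOpen_Iio.preimage (hcont a)).mem_nhds ha] with u' h1 hmem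
    exact ((mem_nntrop_iff.1 hmem).1 a).not_gt h1

/-- If `a + b = 0` and `n • b` comes from `c ∈ Γ`, then `n • a + c = 0` in `Γ`, and pointedness
applies. -/
theorem isAddUnit_toSaturation_iff {a : Γ} : IsAddUnit (toSaturation Γ a) ↔ a = 0 := by
  constructor
  · intro h
    obtain ⟨⟨b, n, hn, c, hc⟩, hb⟩ := isAddUnit_iff_exists_neg.1 h
    obtain ⟨k, rfl⟩ := Nat.exists_eq_succ_of_ne_zero hn
    have hb' : GrothendieckAddGroup.of a + b = 0 := congrArg Subtype.val hb
    have h0 : a + (k • a + c) = 0 := by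
      apply (GrothendieckAddGroup.of_injective : Function.Injective
        (GrothendieckAddGroup.of : Γ →+ GrothendieckAddGroup Γ))
      rw [← add_assoc, ← succ_nsmul', map_add, map_nsmul, ← hc, ← smul_add, hb', smul_zero,
        map_zero]
    exact congrArg AddUnits.val (Subsingleton.elim
      (⟨a, k • a + c, h0, by rw [add_comm]; exact h0⟩ : AddUnits Γ) 0)
  · rintro rfl
    rw [map_zero]
    exact isAddUnit_zero

theorem ptrop_eq [IsAddTorsionFree Γ] (I : Ideal (FormalToricRing K Γ)) :
    ptrop I = nntrop I ∩ extendedConeInterior Γ := by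
  have hsub : tropMap (toQuotient I) '' localValuations (FormalToricRing K Γ ⧸ I) ⊆ nntrop I :=
    Set.image_mono fun v hv => hv.1
  refine Set.Subset.antisymm
    (Set.inter_subset_inter_left _ ((isClosed_nntrop I).closure_subset_iff.2 hsub)) ?_
  rintro u ⟨⟨v, hv, rfl⟩, hu⟩
  refine ⟨subset_closure ⟨v, ⟨hv, fun x hx => ?_⟩, rfl⟩, hu⟩
  obtain ⟨F, rfl⟩ := Ideal.Quotient.mk_surjective x
  refine lt_valuation_of_forall_lt hv WithTop.zero_ne_top fun m hm => ?_
  rw [← LinearVariety.ofHom_apply]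
  refine hu.2 _ fun hunit => ?_
  rw [isAddUnit_toSaturation_iff] at hunit
  subst hunit
  -- A representative of a non-unit has zero constant term, so all its monomials have positive
  -- value.
  exact hx ((isUnit_of_apply_zero_ne_zero hm).map (Ideal.Quotient.mk I))

/-! ### The intersection with the strata -/

instance : Module.Finite ℝ (RealDual Γ) := by
  obtain ⟨S, hS⟩ := (inferInstance : AddMonoid.FG Γ).fg_top
  let f : RealDual Γ →ₗ[ℝ] (S → ℝ) :=
    { toFun := fun w s => w (GrothendieckAddGroup.of (s : Γ))
      map_add' := fun _ _ => rfl
      map_smul' := fun _ _ => rfl }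
  refine Module.Finite.of_injective f fun v w hvw => ?_
  have h : v.comp (GrothendieckAddGroup.of : Γ →+ GrothendieckAddGroup Γ) =
      w.comp (GrothendieckAddGroup.of : Γ →+ GrothendieckAddGroup Γ) :=
    AddMonoidHom.eq_of_eqOn_denseM hS fun s hs => congrFun hvw ⟨s, hs⟩
  exact GrothendieckAddGroup.lift.symm.injective h

open Classical in
/-- The pairing of the stratum of `τ` with `a ∈ Γ ∩ τ^⊥`, and `0` for the other elements. -/
def stratumWeight (τ : PointedCone ℝ (RealDual Γ)) (a : Γ) : Stratum τ →ₗ[ℝ] ℝ :=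
  if h : InPerp τ (toSaturation Γ a : GrothendieckAddGroup Γ) then stratumEval τ _ h else 0

theorem stratumMap_toSaturation_of_mem {τ : PointedCone ℝ (RealDual Γ)}
    (hτ : τ.IsFaceOf (dualCone Γ)) (x : Stratum τ) {a : Γ}
    (ha : InPerp τ (toSaturation Γ a : GrothendieckAddGroup Γ)) :
    stratumMap τ hτ x (toSaturation Γ a) = (stratumWeight τ a x : ℝ) := by
  rw [stratumWeight, dif_pos ha]
  exact dif_pos ha

theorem stratumMap_toSaturation_of_notMem {τ : PointedCone ℝ (RealDual Γ)}
    (hτ : τ.IsFaceOf (dualCone Γ)) (x : Stratum τ) {a : Γ}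
    (ha : ¬ InPerp τ (toSaturation Γ a : GrothendieckAddGroup Γ)) :
    stratumMap τ hτ x (toSaturation Γ a) = ⊤ :=
  dif_neg ha

theorem isWeightFamily_stratumWeight {τ : PointedCone ℝ (RealDual Γ)}
    (hτ : τ.IsFaceOf (dualCone Γ)) :
    IsWeightFamily {a : Γ | InPerp τ (toSaturation Γ a : GrothendieckAddGroup Γ)}
      (stratumWeight τ) where
  face a b := by
    have := inPerp_add_iff hτ.le (toSaturation Γ a) (toSaturation Γ b)
    rwa [← map_add] at this
  add a ha b hb := by
    refine LinearMap.ext fun x => ?_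
    have hab := (inPerp_add_iff hτ.le (toSaturation Γ a) (toSaturation Γ b)).2 ⟨ha, hb⟩
    rw [← map_add] at hab
    rw [LinearMap.add_apply, ← WithTop.coe_inj, WithTop.coe_add,
      ← stratumMap_toSaturation_of_mem hτ x ha, ← stratumMap_toSaturation_of_mem hτ x hb,
      ← stratumMap_toSaturation_of_mem hτ x hab, map_add, map_add]

theorem stratumWeight_integral (τ : PointedCone ℝ (RealDual Γ)) (a : Γ) :
    ∀ x ∈ stratumLattice τ, ∃ k : ℤ, stratumWeight τ a x = k := by
  rintro _ ⟨w, hw, rfl⟩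
  unfold stratumWeight
  split_ifs with h
  · exact hw _
  · exact ⟨0, by simp⟩

/-- Exponents outside `τ^⊥` have infinite weight: they cannot be initial and impose no condition. -/
theorem preimage_stratumMap_nntrop (I : Ideal (FormalToricRing K Γ))
    {τ : PointedCone ℝ (RealDual Γ)} (hτ : τ.IsFaceOf (dualCone Γ)) :
    stratumMap τ hτ ⁻¹' nntrop I = monomialFreeWeights I
      {a : Γ | InPerp τ (toSaturation Γ a : GrothendieckAddGroup Γ)} (stratumWeight τ) := by
  ext x
  rw [Set.mem_preimage, mem_nntrop_iff]
  refine and_congr ⟨fun h a ha => ?_, fun h a => ?_⟩ (not_congr ⟨?_, ?_⟩)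
  · have := h a
    rw [stratumMap_toSaturation_of_mem hτ x ha] at this
    exact WithTop.coe_nonneg.1 this
  · by_cases ha : InPerp τ (toSaturation Γ a : GrothendieckAddGroup Γ)
    · rw [stratumMap_toSaturation_of_mem hτ x ha]
      exact WithTop.coe_nonneg.2 (h a ha)
    · rw [stratumMap_toSaturation_of_notMem hτ x ha]
      exact le_top
  · rintro ⟨f, hf, m, hm, hfm, hlt⟩
    have hmΦ : InPerp τ (toSaturation Γ m : GrothendieckAddGroup Γ) := by
      by_contra h
      exact hm (stratumMap_toSaturation_of_notMem hτ x h)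
    refine ⟨f, hf, m, hmΦ, hfm, fun m' hm' hne hfm' => ?_⟩
    have := hlt m' hne hfm'
    beta_reduce at this
    rwa [stratumMap_toSaturation_of_mem hτ x hmΦ, stratumMap_toSaturation_of_mem hτ x hm',
      WithTop.coe_lt_coe] at this
  · rintro ⟨f, hf, m, hm, hfm, hlt⟩
    refine ⟨f, hf, m, ?_, hfm, fun m' hne hfm' => ?_⟩ <;> beta_reduce
    · rw [stratumMap_toSaturation_of_mem hτ x hm]
      exact WithTop.coe_ne_top
    · rw [stratumMap_toSaturation_of_mem hτ x hm]
      by_cases hm' : InPerp τ (toSaturation Γ m' : GrothendieckAddGroup Γ)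
      · rw [stratumMap_toSaturation_of_mem hτ x hm', WithTop.coe_lt_coe]
        exact hlt m' hm' hne hfm'
      · rw [stratumMap_toSaturation_of_notMem hτ x hm']
        exact WithTop.coe_lt_top _

theorem isRationalPLConicalSubspace_nntrop [IsAddTorsionFree Γ]
    (I : Ideal (FormalToricRing K Γ)) : IsRationalPLConicalSubspace (nntrop I) := by
  intro τ hτ
  -- Integral functionals form a group, so the differences of weights cutting out the cells are
  -- again integral.
  let L : AddSubgroup (Stratum τ →ₗ[ℝ] ℝ) :=
    { carrier := {φ | ∀ x ∈ stratumLattice τ, ∃ k : ℤ, φ x = k}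
      zero_mem' := fun x _ => ⟨0, by simp⟩
      add_mem' := fun {φ ψ} hφ hψ x hx => by
        obtain ⟨a, ha⟩ := hφ x hx
        obtain ⟨b, hb⟩ := hψ x hx
        exact ⟨a + b, by rw [LinearMap.add_apply, ha, hb, Int.cast_add]⟩
      neg_mem' := fun {φ} hφ x hx => by
        obtain ⟨a, ha⟩ := hφ x hx
        exact ⟨-a, by rw [LinearMap.neg_apply, ha, Int.cast_neg]⟩ }
  obtain ⟨𝒞, hfin, hC, h⟩ := exists_finite_cones (isWeightFamily_stratumWeight hτ) (L := L)
    (fun a _ => stratumWeight_integral τ a) I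
  -- An empty intersection is covered too, as the union of the empty family.
  exact Or.inr ⟨𝒞, hfin, hC, (preimage_stratumMap_nntrop I hτ).trans h⟩

end LocalTropicalization

end

theorem mainTheorem8 {K : Type*} [Field K] {Γ : Type*} [AddCancelCommMonoid Γ] [AddMonoid.FG Γ]
    [IsAddTorsionFree Γ] [Subsingleton (AddUnits Γ)] (I : Ideal (FormalToricRing K Γ)) :
    (nntrop I ⊆ extendedCone Γ ∧ IsRationalPLConicalSubspace (nntrop I)) ∧
      IsRationalPLConicalSubspaceIn (extendedConeInterior Γ) (ptrop I) :=
  ⟨⟨nntrop_subset_extendedCone I, isRationalPLConicalSubspace_nntrop I⟩,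
    nntrop I, isRationalPLConicalSubspace_nntrop I, ptrop_eq I⟩
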